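/- Let $k$ be a field of characteristic different from $2$. A sign $(-1)^{|x||y|}$ refers to the parities $|x|,|y|\in\mathbb Z_2$ of homogeneous elements, and formulas with such signs are for homogeneous elements. A *symmetric composition superalgebra* over $k$ is a superalgebra $S=S_{\bar 0}\oplus S_{\bar 1}$ (product $xy$, not necessarily associative or unital) with a quadratic superform $q=(q_{\bar 0},b)$, where $q_{\bar 0}$ is a quadratic form on $S_{\bar 0}$ and $b$ is a bilinear form on $S$ with $b(S_{\bar 0},S_{\bar 1})=0=b(S_{\bar 1},S_{\bar 0})$, whose restriction to $S_{\bar 0}$ is the polar form of $q_{\bar 0}$ and whose restriction to $S_{\bar 1}$ is alternating, such that $b$ is nondegenerate on $S_{\bar 0}$ and on $S_{\bar 1}$ and $$q_{\bar 0}(x_{\bar 0}y_{\bar 0})=q_{\bar 0}(x_{\bar 0})q_{\bar 0}(y_{\bar 0}),\qquad b(x_{\bar 0}y,x_{\bar 0}z)=q_{\bar 0}(x_{\bar 0})b(y,z)=b(yx_{\bar 0},zx_{\bar 0}),$$ $$b(xy,zt)+(-1)^{|x||y|+|x||z|+|y||z|}b(zy,xt)=(-1)^{|y||z|}b(x,z)b(y,t),\qquad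 b(xy,z)=b(x,yz)$$ for all $x_{\bar 0},y_{\bar 0}\in S_{\bar 0}$ and homogeneous $x,y,z,t\in S$. Let $\mathfrak{osp}(S,q)_i$ be the space of endomorphisms $d$ of $S$ of parity $i$ with $b(d(x),y)+(-1)^{i|x|}b(x,d(y))=0$. Let $\mathfrak{tri}(S)=\mathfrak{tri}(S)_{\bar 0}\oplus\mathfrak{tri}(S)_{\bar 1}$, where $\mathfrak{tri}(S)_i$ is the set of $(d_0,d_1,d_2)\in\mathfrak{osp}(S,q)_i^3$ with $d_0(xy)=d_1(x)y+(-1)^{i|x|}x\,d_2(y)$ for all $x,y$, with the componentwise supercommutator as bracket. Let $\theta(d_0,d_1,d_2)=(d_2,d_0,d_1)$, and for homogeneous $x,y\in S$ put $$t_{x,y}=\bigl(\sigma_{x,y},\ \tfrac12 b(x,y)1-r_xl_y,\ \tfrac12 b(x,y)1-l_xr_y\bigr),$$ where $l_x(z)=xz$, $r_x(z)=(-1)^{|x||z|}zx$ and $\sigma_{x,y}(z)=(-1)^{|y||z|}b(x,z)y-(-1)^{|x|(|y|+|z|)}b(y,z)x$. **Theorem.** Let $S$ and $S'$ be symmetric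 composition superalgebras over $k$, with bilinear forms $b$ and $b'$, and write $\theta'$, $t'$ for the analogues of $\theta$, $t$ on $S'$. On the superspace $$\mathfrak g(S,S')=\mathfrak{tri}(S)\oplus\mathfrak{tri}(S')\oplus\bigoplus_{i=0}^{2}\iota_i(S\otimes S'),$$ where the $\iota_i(S\otimes S')$ are three copies of $S\otimes S'$, there is exactly one superanticommutative multiplication $[\cdot,\cdot]$ such that $\mathfrak{tri}(S)\oplus\mathfrak{tri}(S')$ is a subsuperalgebra, with the direct sum bracket of $\mathfrak{tri}(S)$ and $\mathfrak{tri}(S')$, and for $i=0,1,2$ (indices modulo $3$) and homogeneous elements - $[(d_0,d_1,d_2),\iota_i(x\otimes x')]=\iota_i(d_i(x)\otimes x')$, - $[(d'_0,d'_1,d'_2),\iota_i(x\otimes x')]=(-1)^{|d'_i||x|}\iota_i(x\otimes d'_i(x'))$, - $[\iota_i(x\otimes x'),\iota_{i+1}(y\otimes y')]=(-1)^{|x'||y|}\iota_{i+2}(xy\otimes x'y')$, - $[\iota_i(x\otimes x'),\iota_i(y\otimes y')]=(-1)^{|x||x'|+|x||y'|+|y||y'|}b'(x',y')\,\theta^i(t_{x,y})+(-1)^{|y||x'|}b(x,y)\,\theta'^i(t'_{x',y'})$.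 (In particular, $\theta^i(t_{x,y})$ and $\theta'^i(t'_{x',y'})$ enter these brackets as elements of $\mathfrak{tri}(S)$ and $\mathfrak{tri}(S')$.) This multiplication is $\mathbb Z_2\times\mathbb Z_2$-graded, with $\mathfrak{tri}(S)\oplus\mathfrak{tri}(S')$ in degree $(\bar 0,\bar 0)$ and $\iota_0(S\otimes S')$, $\iota_1(S\otimes S')$, $\iota_2(S\otimes S')$ in degrees $(\bar 1,\bar 0)$, $(\bar 0,\bar 1)$, $(\bar 1,\bar 1)$, and with it $\mathfrak g(S,S')$ is a Lie superalgebra (including the law $[x,[x,x]]=0$ for odd $x$, which in characteristic $3$ is part of the definition). -/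

import Mathlib

open scoped TensorProduct

universe u v w

/-- The sign `(-1)^a` in the field `k`, for an exponent `a` in `ℤ/2`. -/
def superSign (k : Type u) [Field k] (a : ZMod 2) : k := if a = 0 then 1 else -1

/-- The family of subspaces `gr` is a grading of the (not necessarily associative) algebra
with underlying space `L` and multiplication `mul`. -/
structure IsAlgebraGrading {k : Type u} [Field k] {L : Type v} [AddCommGroup L] [Module k L]
    {ι : Type*} [DecidableEq ι] [AddCommGroup ι]
    (gr : ι → Submodule k L) (mul : L →ₗ[k] L →ₗ[k] L) : Prop where
  isInternal : DirectSum.IsInternal gr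
  mul_mem : ∀ {p q : ι} {x y : L}, x ∈ gr p → y ∈ gr q → mul x y ∈ gr (p + q)

/-- The multiplication `mul` is superanticommutative for the parity `gr`:
`xy = -(-1)^{|x||y|} yx`. -/
def IsSuperanticommutative {k : Type u} [Field k] {L : Type v} [AddCommGroup L] [Module k L]
    (gr : ZMod 2 → Submodule k L) (mul : L →ₗ[k] L →ₗ[k] L) : Prop :=
  ∀ (p q : ZMod 2) (x y : L), x ∈ gr p → y ∈ gr q →
    mul x y = -(superSign k (p * q) • mul y x)

/-- `L`, with parity `gr` and bracket `br`, is a Lie superalgebra over the field `k` of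
characteristic not two. The law `odd_cube` follows from the Jacobi identity unless the
characteristic is three, where it is part of the definition. -/
structure IsLieSuperalgebra {k : Type u} [Field k] {L : Type v} [AddCommGroup L] [Module k L]
    (gr : ZMod 2 → Submodule k L) (br : L →ₗ[k] L →ₗ[k] L) : Prop where
  grading : IsAlgebraGrading gr br
  anticomm : IsSuperanticommutative gr br
  jacobi : ∀ (p q r : ZMod 2) (x y z : L), x ∈ gr p → y ∈ gr q → z ∈ gr r →
    br x (br y z) = br (br x y) z + superSign k (p * q) • br y (br x z)
  even_self : ∀ x : L, x ∈ gr 0 → br x x = 0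
  odd_cube : ∀ x : L, x ∈ gr 1 → br x (br x x) = 0

/-- A superalgebra structure over `k` on the vector space `S`. -/
structure Superalgebra (k : Type u) [Field k] (S : Type v) [AddCommGroup S] [Module k S] where
  gr : ZMod 2 → Submodule k S
  mul : S →ₗ[k] S →ₗ[k] S
  isGrading : IsAlgebraGrading gr mul

/-- A quadratic superform `(q0, b)` on a `ℤ/2`-graded vector space. -/
structure QuadraticSuperform {k : Type u} [Field k] {S : Type v} [AddCommGroup S] [Module k S]
    (gr : ZMod 2 → Submodule k S) where
  q0 : QuadraticForm k (gr 0)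
  b : LinearMap.BilinForm k S
  b_symm : ∀ x ∈ gr 0, ∀ y ∈ gr 0, b x y = b y x
  b_alt : ∀ x ∈ gr 1, b x x = 0
  b_even_odd : ∀ x ∈ gr 0, ∀ y ∈ gr 1, b x y = 0
  b_odd_even : ∀ x ∈ gr 1, ∀ y ∈ gr 0, b x y = 0
  b_polar : ∀ x y : gr 0, b x y = q0 (x + y) - q0 x - q0 y

/-- Regularity of a quadratic superform over a field of characteristic not two: the bilinear
form is nondegenerate on the even part and on the odd part. -/
def QuadraticSuperform.IsRegular {k : Type u} [Field k] {S : Type v} [AddCommGroup S]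
    [Module k S] {gr : ZMod 2 → Submodule k S} (Q : QuadraticSuperform gr) : Prop :=
  ∀ p : ZMod 2, ∀ x ∈ gr p, (∀ y ∈ gr p, Q.b x y = 0) → x = 0

/-- A composition superalgebra structure on `S`: a superalgebra with a regular quadratic
superform (the norm) that satisfies the composition laws. -/
structure CompositionSuperalgebra (k : Type u) [Field k] (S : Type v) [AddCommGroup S]
    [Module k S] extends Superalgebra k S where
  norm : QuadraticSuperform gr
  regular : norm.IsRegular
  norm_mul : ∀ x y : gr 0,
    norm.q0 ⟨mul x y, by simpa using isGrading.mul_mem x.2 y.2⟩ = norm.q0 x * norm.q0 y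
  b_mul_left : ∀ (x : gr 0) (y z : S), norm.b (mul x y) (mul x z) = norm.q0 x * norm.b y z
  b_mul_right : ∀ (x : gr 0) (y z : S), norm.b (mul y x) (mul z x) = norm.q0 x * norm.b y z
  b_mul_mul : ∀ (p q r s : ZMod 2) (x y z t : S), x ∈ gr p → y ∈ gr q → z ∈ gr r → t ∈ gr s →
    norm.b (mul x y) (mul z t)
        + superSign k (p * q + p * r + q * r) * norm.b (mul z y) (mul x t)
      = superSign k (q * r) * (norm.b x z * norm.b y t)

/-- A symmetric composition superalgebra structure on `S`: the bilinear form is associative. -/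
structure SymmetricCompositionSuperalgebra (k : Type u) [Field k] (S : Type v)
    [AddCommGroup S] [Module k S] extends CompositionSuperalgebra k S where
  b_assoc : ∀ x y z : S, norm.b (mul x y) z = norm.b x (mul y z)

namespace SymmetricCompositionSuperalgebra

section Triality

variable {k : Type u} [Field k] {S : Type v} [AddCommGroup S] [Module k S]
  (A : SymmetricCompositionSuperalgebra k S)

/-- The bilinear form of the norm. -/
abbrev b : LinearMap.BilinForm k S := A.norm.b

/-- The part of parity `p` of the orthosymplectic Lie superalgebra of the norm (over a field of
characteristic not two): the homogeneous endomorphisms `d` of parity `p` with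
`b (d x) y + (-1)^{p|x|} b x (d y) = 0`. -/
def osp (p : ZMod 2) : Submodule k (Module.End k S) where
  carrier := {d | (∀ (q : ZMod 2), ∀ x ∈ A.gr q, d x ∈ A.gr (p + q)) ∧
    ∀ (q : ZMod 2), ∀ x ∈ A.gr q, ∀ y : S,
      A.b (d x) y + superSign k (p * q) * A.b x (d y) = 0}
  zero_mem' := by simp
  add_mem' := by
    rintro d e ⟨hd, hd'⟩ ⟨he, he'⟩
    refine ⟨fun q x hx => add_mem (hd q x hx) (he q x hx), fun q x hx y => ?_⟩
    simp only [LinearMap.add_apply, map_add]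
    linear_combination hd' q x hx y + he' q x hx y
  smul_mem' := by
    rintro c d ⟨hd, hd'⟩
    refine ⟨fun q x hx => Submodule.smul_mem _ c (hd q x hx), fun q x hx y => ?_⟩
    simp only [LinearMap.smul_apply, map_smul, smul_eq_mul]
    linear_combination c * hd' q x hx y

/-- The part of parity `p` of the triality Lie superalgebra, inside the triples of
endomorphisms of `S`. -/
def triPart (p : ZMod 2) : Submodule k (Fin 3 → Module.End k S) where
  carrier := {d | (∀ j, d j ∈ A.osp p) ∧
    ∀ (q : ZMod 2), ∀ x ∈ A.gr q, ∀ y : S,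
      d 0 (A.mul x y) = A.mul (d 1 x) y + superSign k (p * q) • A.mul x (d 2 y)}
  zero_mem' := by simp
  add_mem' := by
    rintro d e ⟨hd, hd'⟩ ⟨he, he'⟩
    refine ⟨fun j => add_mem (hd j) (he j), fun q x hx y => ?_⟩
    simp only [Pi.add_apply, LinearMap.add_apply, map_add, hd' q x hx y, he' q x hx y, smul_add]
    abel
  smul_mem' := by
    rintro c d ⟨hd, hd'⟩
    refine ⟨fun j => Submodule.smul_mem _ c (hd j), fun q x hx y => ?_⟩
    simp only [Pi.smul_apply, LinearMap.smul_apply, map_smul, hd' q x hx y, smul_add,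
      smul_comm c]

/-- The triality Lie superalgebra, the sum of its even and its odd part. -/
def tri : Submodule k (Fin 3 → Module.End k S) := A.triPart 0 ⊔ A.triPart 1

/-- The parity grading of the triality Lie superalgebra. -/
def triGr (p : ZMod 2) : Submodule k A.tri := (A.triPart p).comap A.tri.subtype

/-- The map `(d₀, d₁, d₂) ↦ (d₂, d₀, d₁)` on triples of endomorphisms of `S`. -/
def theta : Module.End k (Fin 3 → Module.End k S) :=
  LinearMap.pi ![LinearMap.proj 2, LinearMap.proj 0, LinearMap.proj 1]

/-- The projection of `S` onto its homogeneous component of parity `p`. -/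
noncomputable def proj (p : ZMod 2) : Module.End k S :=
  letI := A.isGrading.isInternal.chooseDecomposition
  (A.gr p).subtype ∘ₗ DirectSum.component k (ZMod 2) (fun i => A.gr i) p ∘ₗ
    (DirectSum.decomposeLinearEquiv A.gr).toLinearMap

/-- The operator `z ↦ (-1)^{p|z|} z` on `S`. -/
noncomputable def twist (p : ZMod 2) : Module.End k S :=
  A.proj 0 + superSign k p • A.proj 1

/-- Left multiplication `l_x : z ↦ xz`. -/
def lMul (x : S) : Module.End k S := A.mul x

/-- Right multiplication `r_x : z ↦ (-1)^{|x||z|} zx` by an element `x` of parity `p`. -/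
noncomputable def rMul (p : ZMod 2) (x : S) : Module.End k S := A.mul.flip x ∘ₗ A.twist p

/-- The operator `σ_{x,y} : z ↦ (-1)^{|y||z|} b(x,z) y - (-1)^{|x|(|y|+|z|)} b(y,z) x`, for `x`
of parity `p` and `y` of parity `q`. -/
noncomputable def sigma (p q : ZMod 2) (x y : S) : Module.End k S :=
  (A.b x ∘ₗ A.twist q).smulRight y
    - superSign k (p * q) • (A.b y ∘ₗ A.twist p).smulRight x

/-- The triple `t_{x,y} = (σ_{x,y}, ½ b(x,y) 1 - r_x l_y, ½ b(x,y) 1 - l_x r_y)`, for `x` of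
parity `p` and `y` of parity `q`. -/
noncomputable def tTriple (p q : ZMod 2) (x y : S) : Fin 3 → Module.End k S :=
  ![A.sigma p q x y,
    ((2 : k)⁻¹ * A.b x y) • 1 - A.rMul p x * A.lMul y,
    ((2 : k)⁻¹ * A.b x y) • 1 - A.lMul x * A.rMul q y]

end Triality

section Magic

variable {k : Type u} [Field k] {S : Type v} [AddCommGroup S] [Module k S]
  {S' : Type w} [AddCommGroup S'] [Module k S']
  (A : SymmetricCompositionSuperalgebra k S) (A' : SymmetricCompositionSuperalgebra k S')

/-- The vector space `g(S,S') = tri(S) ⊕ tri(S') ⊕ (⊕ᵢ ιᵢ(S ⊗ S'))`. -/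
abbrev Magic : Type (max v w) := A.tri × A'.tri × (Fin 3 → S ⊗[k] S')

/-- The inclusion of `tri(S)` in `g(S,S')`. -/
def inTri : A.tri →ₗ[k] Magic A A' := LinearMap.inl k _ _

/-- The inclusion of `tri(S')` in `g(S,S')`. -/
def inTri' : A'.tri →ₗ[k] Magic A A' := LinearMap.inr k _ _ ∘ₗ LinearMap.inl k _ _

/-- The inclusion `ιᵢ` of the `i`-th copy of `S ⊗ S'` in `g(S,S')`. -/
def iota (i : Fin 3) : S ⊗[k] S' →ₗ[k] Magic A A' :=
  LinearMap.inr k _ _ ∘ₗ LinearMap.inr k _ _ ∘ₗ LinearMap.single k (fun _ => S ⊗[k] S') i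

/-- The parity grading of `S ⊗ S'`. -/
def tensorGr (p : ZMod 2) : Submodule k (S ⊗[k] S') :=
  ⨆ a : ZMod 2, Submodule.map₂ (TensorProduct.mk k S S') (A.gr a) (A'.gr (p - a))

/-- The parity grading of `g(S,S')`. -/
def magicParity (p : ZMod 2) : Submodule k (Magic A A') :=
  (A.triGr p).prod ((A'.triGr p).prod (Submodule.pi Set.univ fun _ => tensorGr A A' p))

/-- The grading of `g(S,S')` by `ℤ/2 × ℤ/2`: the component of degree `(0,0)` is
`tri(S) ⊕ tri(S')`, and those of degree `(1,0)`, `(0,1)`, `(1,1)` are `ι₀(S ⊗ S')`,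
`ι₁(S ⊗ S')`, `ι₂(S ⊗ S')`. -/
def magicGr (c : ZMod 2 × ZMod 2) : Submodule k (Magic A A') :=
  if c = (0, 0) then LinearMap.range (inTri A A') ⊔ LinearMap.range (inTri' A A')
  else if c = (1, 0) then LinearMap.range (iota A A' 0)
  else if c = (0, 1) then LinearMap.range (iota A A' 1)
  else LinearMap.range (iota A A' 2)

/-- The multiplication rules of `g(S,S')`. -/
structure IsMagicBracket (br : Magic A A' →ₗ[k] Magic A A' →ₗ[k] Magic A A') : Prop where
  anticomm : IsSuperanticommutative (magicParity A A') br
  /-- `tri(S)` is a subsuperalgebra with the componentwise supercommutator. -/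
  tri_tri : ∀ (p q : ZMod 2) (d e : A.tri), d ∈ A.triGr p → e ∈ A.triGr q →
    (∀ j, (br (inTri A A' d) (inTri A A' e)).1.1 j
      = d.1 j * e.1 j - superSign k (p * q) • (e.1 j * d.1 j)) ∧
    (br (inTri A A' d) (inTri A A' e)).2 = 0
  /-- `tri(S')` is a subsuperalgebra with the componentwise supercommutator. -/
  tri'_tri' : ∀ (p q : ZMod 2) (d e : A'.tri), d ∈ A'.triGr p → e ∈ A'.triGr q →
    (br (inTri' A A' d) (inTri' A A' e)).1 = 0 ∧
    (∀ j, (br (inTri' A A' d) (inTri' A A' e)).2.1.1 j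
      = d.1 j * e.1 j - superSign k (p * q) • (e.1 j * d.1 j)) ∧
    (br (inTri' A A' d) (inTri' A A' e)).2.2 = 0
  /-- `tri(S)` and `tri(S')` commute. -/
  tri_tri' : ∀ (d : A.tri) (e : A'.tri), br (inTri A A' d) (inTri' A A' e) = 0
  tri_iota : ∀ (d : A.tri) (i : Fin 3) (x : S) (x' : S'),
    br (inTri A A' d) (iota A A' i (x ⊗ₜ x')) = iota A A' i (d.1 i x ⊗ₜ x')
  tri'_iota : ∀ (p q : ZMod 2) (d : A'.tri) (i : Fin 3) (x : S) (x' : S'),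
    d ∈ A'.triGr p → x ∈ A.gr q →
    br (inTri' A A' d) (iota A A' i (x ⊗ₜ x'))
      = superSign k (p * q) • iota A A' i (x ⊗ₜ d.1 i x')
  iota_succ : ∀ (p' q : ZMod 2) (i : Fin 3) (x y : S) (x' y' : S'),
    x' ∈ A'.gr p' → y ∈ A.gr q →
    br (iota A A' i (x ⊗ₜ x')) (iota A A' (i + 1) (y ⊗ₜ y'))
      = superSign k (p' * q) • iota A A' (i + 2) (A.mul x y ⊗ₜ A'.mul x' y')
  iota_iota : ∀ (p q p' q' : ZMod 2) (i : Fin 3) (x y : S) (x' y' : S'),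
    x ∈ A.gr p → y ∈ A.gr q → x' ∈ A'.gr p' → y' ∈ A'.gr q' →
    (br (iota A A' i (x ⊗ₜ x')) (iota A A' i (y ⊗ₜ y'))).1.1
        = (superSign k (p * p' + p * q' + q * q') * A'.b x' y') •
          (theta ^ (i : ℕ)) (A.tTriple p q x y) ∧
    (br (iota A A' i (x ⊗ₜ x')) (iota A A' i (y ⊗ₜ y'))).2.1.1
        = (superSign k (q * p') * A.b x y) •
          (theta ^ (i : ℕ)) (A'.tTriple p' q' x' y') ∧
    (br (iota A A' i (x ⊗ₜ x')) (iota A A' i (y ⊗ₜ y'))).2.2 = 0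

end Magic

end SymmetricCompositionSuperalgebra

/-! Every term of the Jacobi identity reduces to a statement about one symmetric composition
superalgebra, and those statements come from two identities. Associativity and nondegeneracy of `b`
turn the linearised composition law into `mul_mul_add` and `mul_mul_add'`: up to signs, (xy)z +
(zy)x = b(x,z)y = x(yz) + z(yx).

They yield four facts. The triples t_{x,y} lie in tri(S) (`tTriple_mem`). Also t_{y,x} = ∓t_{x,y}
(`tTriple_swap`). The bracket of d in tri(S) with t_{x,y} is obtained by letting d_0 act on x and y
(`superComm_tTriple`). Finally t_{x,yz} + θ(t_{y,zx}) + θ²(t_{z,xy}) = 0 up to signs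
(`tTriple_cyclic`). Independently of the t_{x,y}, tri(S) is stable under θ (`apply_one_mul`), by
moving operators across `b`.

By trilinearity the Jacobi identity is needed only on generators: pairs in tri(S) ⊕ tri(S') and
tensors in a single copy ι_i. With at least two arguments in tri(S) ⊕ tri(S') it says that the
supercommutator satisfies Jacobi and acts on S ⊗ S'. With exactly one it is the derivation property
of t or the triality rule. For three tensors, the index pattern (i,i,i) uses only supersymmetry of
the forms; (i,i,i+1) and (i,i,i+2) use `mul_mul_add` and `mul_mul_add'`; (i,i+1,i+2) is
`tTriple_cyclic` in both algebras. The remaining orders follow from superanticommutativity.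

The law [x,[x,x]] = 0 is cubic, so it is checked on odd generators and spread to sums by its
polarisation, which the Jacobi identity kills without dividing by 3. Uniqueness holds because the
rules and superanticommutativity determine all brackets of generators; existence is an explicit
bilinear construction. -/

set_option linter.unusedSimpArgs false

/-! ### Signs and parities. -/

section Signs
variable {k : Type u} [Field k]

@[simp] theorem superSign_zero : superSign k 0 = 1 := by simp [superSign]

@[simp] theorem superSign_one : superSign k 1 = -1 := by simp [superSign]

theorem ZMod.two_one_add_one : (1 + 1 : ZMod 2) = 0 := rfl

theorem ZMod.two_cases {P : ZMod 2 → Prop} (h0 : P 0) (h1 : P 1) (p : ZMod 2) : P p := by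
  fin_cases p
  exacts [h0, h1]

theorem superSign_add (a b : ZMod 2) : superSign k (a + b) = superSign k a * superSign k b := by
  induction a using ZMod.two_cases <;> induction b using ZMod.two_cases <;>
    simp [ZMod.two_one_add_one]

theorem superSign_mul_self (a : ZMod 2) : superSign k a * superSign k a = 1 := by
  induction a using ZMod.two_cases <;> simp

/-- The Kronecker delta of two parities. -/
def parityDelta (k : Type u) [Field k] (p q : ZMod 2) : k := if p = q then 1 else 0

@[simp] theorem parityDelta_zero_zero : parityDelta k 0 0 = 1 := rfl
@[simp] theorem parityDelta_one_one : parityDelta k 1 1 = 1 := rfl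
@[simp] theorem parityDelta_zero_one : parityDelta k 0 1 = 0 := rfl
@[simp] theorem parityDelta_one_zero : parityDelta k 1 0 = 0 := rfl

end Signs

/-! ### Linear algebra of parity gradings. -/

section Graded
variable {k : Type u} [Field k] {L M N : Type*} [AddCommGroup L] [Module k L]
  [AddCommGroup M] [Module k M] [AddCommGroup N] [Module k N]

/-- Two linear maps that agree on all homogeneous elements are equal. -/
theorem DirectSum.IsInternal.linearMap_ext {gr : ZMod 2 → Submodule k L}
    (h : DirectSum.IsInternal gr) {f g : L →ₗ[k] M} (H : ∀ p, ∀ x ∈ gr p, f x = g x) :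
    f = g := by
  ext x
  have hx : x ∈ ⨆ p, gr p := h.submodule_iSup_eq_top ▸ Submodule.mem_top
  induction hx using Submodule.iSup_induction' with
  | mem p x hx => exact H p x hx
  | zero => simp
  | add x y _ _ hx hy => simp [hx, hy]

theorem isInternal_zmod_two (gr : ZMod 2 → Submodule k L) (h1 : ∀ x, x ∈ gr 0 ⊔ gr 1)
    (h2 : ∀ x, x ∈ gr 0 → x ∈ gr 1 → x = 0) : DirectSum.IsInternal gr := by
  rw [DirectSum.isInternal_submodule_iff_isCompl gr (i := 0) (j := 1) (by decide)
    (by ext p; induction p using ZMod.two_cases <;> simp)]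
  refine ⟨Submodule.disjoint_def.2 h2, codisjoint_iff.2 (eq_top_iff.2 fun x _ => h1 x)⟩

/-- The projection onto the component of degree `p` of an internal grading by parity. -/
noncomputable def gradedProj {gr : ZMod 2 → Submodule k L} (h : DirectSum.IsInternal gr)
    (p : ZMod 2) : L →ₗ[k] L :=
  letI := h.chooseDecomposition
  (gr p).subtype ∘ₗ DirectSum.component k (ZMod 2) (fun i => gr i) p ∘ₗ
    (DirectSum.decomposeLinearEquiv gr).toLinearMap

theorem gradedProj_of_mem {gr : ZMod 2 → Submodule k L} (h : DirectSum.IsInternal gr)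
    {p : ZMod 2} {x : L} (hx : x ∈ gr p) : gradedProj h p x = x := by
  let := h.chooseDecomposition
  change ((DirectSum.decompose gr x) p : L) = x
  exact DirectSum.decompose_of_mem_same _ hx

theorem gradedProj_of_ne {gr : ZMod 2 → Submodule k L} (h : DirectSum.IsInternal gr)
    {p q : ZMod 2} {x : L} (hx : x ∈ gr p) (hpq : p ≠ q) : gradedProj h q x = 0 := by
  let := h.chooseDecomposition
  change ((DirectSum.decompose gr x) q : L) = 0
  exact DirectSum.decompose_of_mem_ne _ hx hpq

theorem gradedProj_eq_delta {gr : ZMod 2 → Submodule k L} (h : DirectSum.IsInternal gr)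
    {p : ZMod 2} (q : ZMod 2) {x : L} (hx : x ∈ gr p) :
    gradedProj h q x = parityDelta k p q • x := by
  by_cases hpq : p = q
  · subst hpq
    simp [parityDelta, gradedProj_of_mem h hx]
  · simp [parityDelta, hpq, gradedProj_of_ne h hx hpq]

/-- The bilinear map that is given by `B p q` on the elements of parities `p` and `q`. -/
noncomputable def superExtend {gl : ZMod 2 → Submodule k L} (hl : DirectSum.IsInternal gl)
    {gm : ZMod 2 → Submodule k M} (hm : DirectSum.IsInternal gm)
    (B : ZMod 2 → ZMod 2 → L →ₗ[k] M →ₗ[k] N) : L →ₗ[k] M →ₗ[k] N :=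
  ∑ p, ∑ q, (B p q).compl₁₂ (gradedProj hl p) (gradedProj hm q)

theorem superExtend_apply {gl : ZMod 2 → Submodule k L} (hl : DirectSum.IsInternal gl)
    {gm : ZMod 2 → Submodule k M} (hm : DirectSum.IsInternal gm)
    (B : ZMod 2 → ZMod 2 → L →ₗ[k] M →ₗ[k] N) {p q : ZMod 2} {x : L} {y : M}
    (hx : x ∈ gl p) (hy : y ∈ gm q) : superExtend hl hm B x y = B p q x y := by
  simp only [superExtend, LinearMap.sum_apply, LinearMap.compl₁₂_apply,
    gradedProj_eq_delta _ _ hx, gradedProj_eq_delta _ _ hy, map_smul, LinearMap.smul_apply]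
  rw [Finset.sum_eq_single p, Finset.sum_eq_single q]
  · simp [parityDelta]
  · intro r _ hr
    simp [parityDelta, hr.symm]
  · simp
  · intro r _ hr
    simp [parityDelta, hr.symm]
  · simp

end Graded

/-! ### The form and the basic identities of a symmetric composition superalgebra. -/

namespace SymmetricCompositionSuperalgebra

section Basic

variable {k : Type u} [Field k] {S : Type v} [AddCommGroup S] [Module k S]
  (A : SymmetricCompositionSuperalgebra k S)

variable {A} {p q r t : ZMod 2} {x y z w : S}

theorem mul_mem (hx : x ∈ A.gr p) (hy : y ∈ A.gr q) : A.mul x y ∈ A.gr (p + q) :=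
  A.isGrading.mul_mem hx hy

theorem proj_eq_gradedProj (p : ZMod 2) : A.proj p = gradedProj A.isGrading.isInternal p := rfl

theorem twist_apply (hx : x ∈ A.gr p) : A.twist q x = superSign k (q * p) • x := by
  simp only [twist, LinearMap.add_apply, LinearMap.smul_apply, proj_eq_gradedProj,
    gradedProj_eq_delta _ _ hx]
  induction p using ZMod.two_cases <;> simp

/-- Makes the orthogonality of the even and the odd part explicit as a scalar factor. Sign
identities that hold only when `b x y` can be nonzero then become true in every parity case, so
splitting on parities and normalising settles them. -/
theorem b_delta (hx : x ∈ A.gr p) (hy : y ∈ A.gr q) :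
    A.b x y = parityDelta k p q * A.b x y := by
  induction p using ZMod.two_cases <;> induction q using ZMod.two_cases <;> simp
  · exact A.norm.b_even_odd x hx y hy
  · exact A.norm.b_odd_even x hx y hy

theorem b_supersymm (hx : x ∈ A.gr p) (hy : y ∈ A.gr q) :
    A.b y x = superSign k (p * q) * A.b x y := by
  induction p using ZMod.two_cases <;> induction q using ZMod.two_cases <;> simp
  · exact A.norm.b_symm y hy x hx
  · rw [b, A.norm.b_even_odd x hx y hy, A.norm.b_odd_even y hy x hx]
  · rw [b, A.norm.b_odd_even x hx y hy, A.norm.b_even_odd y hy x hx]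
  -- On the odd part, alternating gives skew-symmetric by polarisation.
  · have h := A.norm.b_alt (x + y) (add_mem hx hy)
    simp only [map_add, LinearMap.add_apply, A.norm.b_alt x hx, A.norm.b_alt y hy] at h
    simp only [b]
    linear_combination h

theorem eq_of_b_eq (hx : x ∈ A.gr p) (hy : y ∈ A.gr p)
    (h : ∀ q, ∀ z ∈ A.gr q, A.b x z = A.b y z) : x = y := by
  rw [← sub_eq_zero]
  refine A.regular p _ (sub_mem hx hy) fun z hz => ?_
  rw [map_sub, LinearMap.sub_apply, sub_eq_zero]
  exact h p z hz

theorem eq_of_b_eq' (hx : x ∈ A.gr p) (hy : y ∈ A.gr p)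
    (h : ∀ q, ∀ z ∈ A.gr q, A.b z x = A.b z y) : x = y := by
  refine eq_of_b_eq hx hy fun q z hz => ?_
  rw [b_supersymm hz hx, b_supersymm hz hy, h q z hz]

/-- Pair with an arbitrary `w`: associativity gives b((xy)z,w) = b(xy,zw) and b((zy)x,w) = b(zy,xw),
so the claim becomes the linearised composition law, and nondegeneracy removes `w`. -/
theorem mul_mul_add (hx : x ∈ A.gr p) (hy : y ∈ A.gr q) (hz : z ∈ A.gr r) :
    A.mul (A.mul x y) z = (superSign k (q * r) * A.b x z) • y
      - superSign k (p * q + p * r + q * r) • A.mul (A.mul z y) x := by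
  -- Nondegeneracy is available only inside one parity, so both sides must be homogeneous of the
  -- same parity. The scalar vanishes unless p = r.
  have hm : (superSign k (q * r) * A.b x z) • y ∈ A.gr (p + q + r) := by
    rw [b_delta hx hz]
    induction p using ZMod.two_cases <;> induction r using ZMod.two_cases <;>
      simp [add_comm (1 : ZMod 2), add_assoc, ZMod.two_one_add_one] <;>
      exact Submodule.smul_mem _ _ (by simpa using hy)
  refine eq_of_b_eq (mul_mem (mul_mem hx hy) hz) (sub_mem hm (Submodule.smul_mem _ _ ?_))
    fun t w hw => ?_
  · convert mul_mem (mul_mem hz hy) hx using 2; ring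
  · have h := A.b_mul_mul p q r t x y z w hx hy hz hw
    simp only [map_sub, map_smul, LinearMap.sub_apply, LinearMap.smul_apply, smul_eq_mul]
    rw [b, A.b_assoc (A.mul x y), A.b_assoc (A.mul z y)]
    linear_combination h

/-- The mirror image of `mul_mul_add`: pairing with `w` on the left gives b(wx,yz) and b(wz,yx),
again two terms of the linearised composition law. -/
theorem mul_mul_add' (hx : x ∈ A.gr p) (hy : y ∈ A.gr q) (hz : z ∈ A.gr r) :
    A.mul x (A.mul y z) = (superSign k (p * q) * A.b x z) • y
      - superSign k (p * q + p * r + q * r) • A.mul z (A.mul y x) := by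
  have hm : (superSign k (p * q) * A.b x z) • y ∈ A.gr (p + (q + r)) := by
    rw [b_delta hx hz]
    induction p using ZMod.two_cases <;> induction r using ZMod.two_cases <;>
      simp [add_comm (1 : ZMod 2), add_assoc, ZMod.two_one_add_one] <;>
      exact Submodule.smul_mem _ _ (by simpa using hy)
  refine eq_of_b_eq' (mul_mem hx (mul_mem hy hz)) (sub_mem hm (Submodule.smul_mem _ _ ?_))
    fun t w hw => ?_
  · convert mul_mem hz (mul_mem hy hx) using 2; ring
  · have h1 := b_supersymm (mul_mem hw hx) (mul_mem hy hz)
    have h2 := A.b_mul_mul q r t p y z w x hy hz hw hx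
    simp only [map_sub, map_smul, smul_eq_mul]
    have h3 := A.b_assoc w x (A.mul y z)
    have h4 := A.b_assoc w z (A.mul y x)
    have h6 := b_supersymm hw hy
    have h7 := b_supersymm hx hz
    have h8 := b_delta hw hy
    have h9 := b_delta hx hz
    simp only [b] at *
    rw [← h3, ← h4]
    rw [h1, h6, h7, h8, h9] at h2
    rw [h8, h9]
    clear h1 h3 h4 h6 h7 h8 h9 hm
    -- The coefficient undoes the sign of exchanging wx and yz in `b`. What is left is a sign
    -- identity, checked in the sixteen parity cases.
    linear_combination (norm := skip) superSign k ((t + p) * (q + r)) * h2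
    generalize A.norm.b w y = e1
    generalize A.norm.b x z = e2
    induction p using ZMod.two_cases <;> induction q using ZMod.two_cases <;>
    induction r using ZMod.two_cases <;> induction t using ZMod.two_cases <;>
    simp only [superSign_zero, superSign_one, parityDelta_zero_zero, parityDelta_one_one,
      parityDelta_zero_one, parityDelta_one_zero, mul_zero, zero_mul, mul_one, one_mul,
      add_zero, zero_add, ZMod.two_one_add_one] <;> ring

end Basic
end SymmetricCompositionSuperalgebra

/-! ### The triples t_{x,y} belong to tri(S). -/

namespace SymmetricCompositionSuperalgebra

section Triples

variable {k : Type u} [Field k] {S : Type v} [AddCommGroup S] [Module k S]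
  {A : SymmetricCompositionSuperalgebra k S} {p q r t u : ZMod 2} {x y z w : S}

theorem b_mul (x y z : S) : A.b (A.mul x y) z = A.b x (A.mul y z) := A.b_assoc x y z

theorem exists_b_eq (hx : x ∈ A.gr p) (hy : y ∈ A.gr q) :
    ∃ β, A.b x y = parityDelta k p q * β ∧
      A.b y x = superSign k (p * q) * (parityDelta k p q * β) :=
  ⟨_, b_delta hx hy, by rw [b_supersymm hx hy, ← b_delta hx hy]⟩

theorem b_smul_mem (hx : x ∈ A.gr p) (hy : y ∈ A.gr q) (hz : z ∈ A.gr r) :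
    A.b x y • z ∈ A.gr (p + q + r) := by
  rw [b_delta hx hy]
  by_cases h : p = q
  · subst h
    have h0 : (2 : ZMod 2) = 0 := rfl
    have h2 : p + p + r = r := by linear_combination p * h0
    rw [h2]
    exact Submodule.smul_mem _ _ hz
  · simp [parityDelta, h]

/-- Naming half the value of the form makes it possible to eliminate `2⁻¹`, so that the final
identities have integer coefficients in free scalars. -/
theorem exists_half_b_eq (h2 : (2 : k) ≠ 0) (hx : x ∈ A.gr p) (hy : y ∈ A.gr q) :
    ∃ β, A.b x y = parityDelta k p q * (β + β) ∧
      A.b y x = superSign k (p * q) * (parityDelta k p q * (β + β)) ∧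
      2⁻¹ * A.b x y = parityDelta k p q * β := by
  obtain ⟨β, h, h'⟩ := exists_b_eq hx hy
  have h3 : β = 2⁻¹ * β + 2⁻¹ * β := by field_simp; ring
  exact ⟨2⁻¹ * β, by rwa [← h3], by rwa [← h3], by rw [h]; ring⟩

theorem mem_osp_of_homogeneous {d : Module.End k S}
    (h1 : ∀ q, ∀ x ∈ A.gr q, d x ∈ A.gr (p + q))
    (h2 : ∀ q r, ∀ x ∈ A.gr q, ∀ y ∈ A.gr r,
      A.b (d x) y + superSign k (p * q) * A.b x (d y) = 0) : d ∈ A.osp p := by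
  refine ⟨h1, fun q x hx => ?_⟩
  have h : A.b (d x) + superSign k (p * q) • (A.b x ∘ₗ d) = 0 :=
    A.isGrading.isInternal.linearMap_ext fun r y hy => by simpa using h2 q r x hx y hy
  intro y
  simpa using LinearMap.congr_fun h y

theorem mem_triPart_of_homogeneous {d : Fin 3 → Module.End k S} (h1 : ∀ j, d j ∈ A.osp p)
    (h2 : ∀ q r, ∀ x ∈ A.gr q, ∀ y ∈ A.gr r,
      d 0 (A.mul x y) = A.mul (d 1 x) y + superSign k (p * q) • A.mul x (d 2 y)) :
    d ∈ A.triPart p := by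
  refine ⟨h1, fun q x hx => ?_⟩
  have h : d 0 ∘ₗ A.mul x = A.mul (d 1 x) + superSign k (p * q) • (A.mul x ∘ₗ d 2) :=
    A.isGrading.isInternal.linearMap_ext fun r y hy => by simpa using h2 q r x hx y hy
  intro y
  simpa using LinearMap.congr_fun h y

theorem sigma_apply (x y : S) (hz : z ∈ A.gr r) :
    A.sigma p q x y z = (superSign k (q * r) * A.b x z) • y
      - (superSign k (p * q + p * r) * A.b y z) • x := by
  simp [sigma, twist_apply hz, superSign_add, mul_smul]

theorem tTriple_zero (x y : S) (hz : z ∈ A.gr r) :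
    A.tTriple p q x y 0 z = (superSign k (q * r) * A.b x z) • y
      - (superSign k (p * q + p * r) * A.b y z) • x := sigma_apply x y hz

theorem tTriple_one (x : S) (hy : y ∈ A.gr q) (hz : z ∈ A.gr r) :
    A.tTriple p q x y 1 z = ((2 : k)⁻¹ * A.b x y) • z
      - superSign k (p * q + p * r) • A.mul (A.mul y z) x := by
  simp [tTriple, rMul, lMul, twist_apply (mul_mem hy hz), mul_add]

theorem tTriple_two (x y : S) (hz : z ∈ A.gr r) :
    A.tTriple p q x y 2 z = ((2 : k)⁻¹ * A.b x y) • z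
      - superSign k (q * r) • A.mul x (A.mul z y) := by
  simp [tTriple, rMul, lMul, twist_apply hz]

theorem sigma_mem_osp (hx : x ∈ A.gr p) (hy : y ∈ A.gr q) :
    A.sigma p q x y ∈ A.osp (p + q) := by
  refine mem_osp_of_homogeneous (fun r z hz => ?_) fun r u z hz w hw => ?_
  · rw [sigma_apply x y hz, mul_smul, mul_smul]
    refine sub_mem (Submodule.smul_mem _ _ ?_) (Submodule.smul_mem _ _ ?_)
    · convert b_smul_mem hx hz hy using 2; ring
    · convert b_smul_mem hy hz hx using 2; ring
  · obtain ⟨e1, h1, h1'⟩ := exists_b_eq hx hz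
    obtain ⟨e2, h2, h2'⟩ := exists_b_eq hy hz
    rw [sigma_apply x y hz, sigma_apply x y hw]
    simp only [map_sub, map_smul, LinearMap.sub_apply, LinearMap.smul_apply, smul_eq_mul]
    rw [b_delta hx hw, b_delta hy hw, h1, h1', h2, h2']
    generalize A.b x w = e3
    generalize A.b y w = e4
    induction p using ZMod.two_cases <;> induction q using ZMod.two_cases <;>
    induction r using ZMod.two_cases <;> induction u using ZMod.two_cases <;>
    simp only [superSign_zero, superSign_one, parityDelta_zero_zero, parityDelta_one_one,
      parityDelta_zero_one, parityDelta_one_zero, mul_zero, zero_mul, mul_one, one_mul,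
      add_zero, zero_add, ZMod.two_one_add_one] <;> ring

/-- Moving factors across `b` turns b((yz)x,w) and b(z,(yw)x) into b(yz,xw) and b(xz,yw), up to
sign. Their sum is b(x,y)b(z,w) by the composition law, which the two summands ½b(x,y)1 compensate.
-/
theorem tTriple_one_mem_osp (h2 : (2 : k) ≠ 0) (hx : x ∈ A.gr p) (hy : y ∈ A.gr q) :
    A.tTriple p q x y 1 ∈ A.osp (p + q) := by
  refine mem_osp_of_homogeneous (fun r z hz => ?_) fun r u z hz w hw => ?_
  · rw [tTriple_one x hy hz, mul_smul]
    refine sub_mem (Submodule.smul_mem _ _ (b_smul_mem hx hy hz)) (Submodule.smul_mem _ _ ?_)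
    convert mul_mem (mul_mem hy hz) hx using 2; ring
  · rw [tTriple_one x hy hz, tTriple_one x hy hw]
    simp only [map_sub, map_smul, LinearMap.sub_apply, LinearMap.smul_apply, smul_eq_mul]
    obtain ⟨e1, h1, h1', h1c⟩ := exists_half_b_eq h2 hx hy
    have h := A.b_mul_mul q r p u y z x w hy hz hx hw
    change A.b _ _ + _ * A.b _ _ = _ * (A.b _ _ * A.b _ _) at h
    have h3 := b_supersymm (mul_mem (mul_mem hy hw) hx) hz
    rw [b_mul] at h3
    rw [b_supersymm (mul_mem hy hw) (mul_mem hx hz), h1', b_delta hz hw] at h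
    rw [b_mul, h3, h1c, b_delta hz hw]
    linear_combination (norm := skip) -superSign k (p * q + p * r) * h
    clear h h3 h1 h1' h1c
    generalize A.b z w = e3
    induction p using ZMod.two_cases <;> induction q using ZMod.two_cases <;>
    induction r using ZMod.two_cases <;> induction u using ZMod.two_cases <;>
    simp only [superSign_zero, superSign_one, parityDelta_zero_zero, parityDelta_one_one,
      parityDelta_zero_one, parityDelta_one_zero, mul_zero, zero_mul, mul_one, one_mul,
      add_zero, zero_add, ZMod.two_one_add_one] <;> ring

theorem tTriple_two_mem_osp (h2 : (2 : k) ≠ 0) (hx : x ∈ A.gr p) (hy : y ∈ A.gr q) :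
    A.tTriple p q x y 2 ∈ A.osp (p + q) := by
  refine mem_osp_of_homogeneous (fun r z hz => ?_) fun r u z hz w hw => ?_
  · rw [tTriple_two x y hz, mul_smul]
    refine sub_mem (Submodule.smul_mem _ _ (b_smul_mem hx hy hz)) (Submodule.smul_mem _ _ ?_)
    convert mul_mem hx (mul_mem hz hy) using 2; ring
  · rw [tTriple_two x y hz, tTriple_two x y hw]
    simp only [map_sub, map_smul, LinearMap.sub_apply, LinearMap.smul_apply, smul_eq_mul]
    obtain ⟨e1, h1, h1', h1c⟩ := exists_half_b_eq h2 hx hy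
    have h := A.b_mul_mul r p u q z x w y hz hx hw hy
    change A.b _ _ + _ * A.b _ _ = _ * (A.b _ _ * A.b _ _) at h
    have h3 := b_supersymm hw (mul_mem hx (mul_mem hz hy))
    rw [← b_mul w] at h3
    rw [h1, b_delta hz hw] at h
    rw [h3, ← b_mul z, h1c, b_delta hz hw]
    linear_combination (norm := skip) -superSign k ((p + q) * r + q * u) * h
    clear h h3 h1 h1' h1c
    generalize A.b z w = e3
    induction p using ZMod.two_cases <;> induction q using ZMod.two_cases <;>
    induction r using ZMod.two_cases <;> induction u using ZMod.two_cases <;>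
    simp only [superSign_zero, superSign_one, parityDelta_zero_zero, parityDelta_one_one,
      parityDelta_zero_one, parityDelta_one_zero, mul_zero, zero_mul, mul_one, one_mul,
      add_zero, zero_add, ZMod.two_one_add_one] <;> ring

/-- The terms ((yz)x)w and z(x(wy)) are rewritten by the basic identities until both contain
(wx)(yz), which cancels. The multiples of b(x,y)zw cancel as ½ + ½ - 1, and the two remaining terms
are σ_{x,y}(zw). -/
theorem tTriple_triality (h2 : (2 : k) ≠ 0) (hx : x ∈ A.gr p) (hy : y ∈ A.gr q)
    (hz : z ∈ A.gr r) (hw : w ∈ A.gr u) :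
    A.tTriple p q x y 0 (A.mul z w) = A.mul (A.tTriple p q x y 1 z) w
      + superSign k ((p + q) * r) • A.mul z (A.tTriple p q x y 2 w) := by
  rw [tTriple_zero x y (mul_mem hz hw), tTriple_one x hy hz, tTriple_two x y hw]
  simp only [map_sub, map_smul, LinearMap.sub_apply, LinearMap.smul_apply]
  rw [mul_mul_add (mul_mem hy hz) hx hw, mul_mul_add' hx hw hy]
  simp only [map_sub, map_smul]
  rw [mul_mul_add' hz hy (mul_mem hw hx), b_mul y z w, ← b_mul z w x]
  obtain ⟨e1, h1, h1', h1c⟩ := exists_half_b_eq h2 hx hy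
  rw [h1c, h1, b_supersymm hx (mul_mem hz hw), b_delta hx (mul_mem hz hw),
    b_delta hy (mul_mem hz hw)]
  clear h1 h1' h1c
  generalize A.b x (A.mul z w) = e2
  generalize A.b y (A.mul z w) = e3
  generalize A.mul (A.mul w x) (A.mul y z) = v
  generalize A.mul z w = v'
  induction p using ZMod.two_cases <;> induction q using ZMod.two_cases <;>
  induction r using ZMod.two_cases <;> induction u using ZMod.two_cases <;>
  simp only [superSign_zero, superSign_one, parityDelta_zero_zero, parityDelta_one_one,
    parityDelta_zero_one, parityDelta_one_zero, mul_zero, zero_mul, mul_one, one_mul,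
    add_zero, zero_add, ZMod.two_one_add_one] <;> module

theorem tTriple_mem (h2 : (2 : k) ≠ 0) (hx : x ∈ A.gr p) (hy : y ∈ A.gr q) :
    A.tTriple p q x y ∈ A.triPart (p + q) := by
  refine mem_triPart_of_homogeneous (fun j => ?_) fun r u z hz w hw =>
    tTriple_triality h2 hx hy hz hw
  fin_cases j
  exacts [sigma_mem_osp hx hy, tTriple_one_mem_osp h2 hx hy, tTriple_two_mem_osp h2 hx hy]

/-- Cyclic invariance of the trilinear form b(x,yz), which later gives the three terms of a mixed
Jacobi identity a common coefficient. -/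
theorem b_mul_rotate (hx : x ∈ A.gr p) (hy : y ∈ A.gr q) (hz : z ∈ A.gr r) :
    A.b y (A.mul z x) = superSign k (p * (q + r)) * A.b x (A.mul y z) := by
  rw [← b_mul, b_supersymm hx (mul_mem hy hz)]

/-- The zeroth component of the cyclic identity for the triples `t_{x,yz}`. -/
theorem tTriple_cyclic_zero (h2 : (2 : k) ≠ 0) (hx : x ∈ A.gr p) (hy : y ∈ A.gr q)
    (hz : z ∈ A.gr r) :
    A.tTriple p (q + r) x (A.mul y z) 0
      + superSign k (p * (q + r)) • A.tTriple q (r + p) y (A.mul z x) 2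
      + superSign k (r * (p + q)) • A.tTriple r (p + q) z (A.mul x y) 1 = 0 := by
  refine A.isGrading.isInternal.linearMap_ext fun u w hw => ?_
  simp only [LinearMap.add_apply, LinearMap.smul_apply, LinearMap.zero_apply]
  rw [tTriple_zero _ _ hw, tTriple_two _ _ hw, tTriple_one _ (mul_mem hx hy) hw]
  obtain ⟨e1, h1, h1', h1c⟩ := exists_half_b_eq h2 hx (mul_mem hy hz)
  have h3 : A.b z (A.mul x y) = superSign k (r * (p + q)) * A.b x (A.mul y z) := by
    rw [b_supersymm (mul_mem hx hy) hz, b_mul, mul_comm r]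
  -- Both y(w(zx)) and ((xy)w)z are rewritten in terms of (zw)(xy), whose two occurrences cancel.
  -- The two halves of b(x,yz)w cancel against b(xy,z)w, and the rest is σ_{x,yz}(w).
  rw [b_mul_rotate hx hy hz, h3, mul_left_comm, mul_left_comm 2⁻¹, h1c,
    mul_mul_add (mul_mem hx hy) hw hz, mul_mul_add' hw hz hx]
  simp only [map_sub, map_smul]
  rw [mul_mul_add' hy hx (mul_mem hz hw), b_mul x, h1, ← b_mul y z w, b_supersymm hx hw,
    b_delta hx hw, b_delta (mul_mem hy hz) hw]
  clear h1 h1' h1c h3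
  generalize A.b x w = e2
  generalize A.b (A.mul y z) w = e3
  generalize A.mul (A.mul z w) (A.mul x y) = v
  generalize A.mul y z = v'
  induction p using ZMod.two_cases <;> induction q using ZMod.two_cases <;>
  induction r using ZMod.two_cases <;> induction u using ZMod.two_cases <;>
  simp only [superSign_zero, superSign_one, parityDelta_zero_zero, parityDelta_one_one,
    parityDelta_zero_one, parityDelta_one_zero, mul_zero, zero_mul, mul_one, one_mul,
    add_zero, zero_add, ZMod.two_one_add_one] <;> module

end Triples
end SymmetricCompositionSuperalgebra

/-! ### Rotation by θ and supercommutators in tri(S). -/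

namespace SymmetricCompositionSuperalgebra

section Triality

variable {k : Type u} [Field k] {S : Type v} [AddCommGroup S] [Module k S]
  {A : SymmetricCompositionSuperalgebra k S} {p q r t u : ZMod 2} {x y z w : S}
  {d e : Fin 3 → Module.End k S}

/-- The index shifts encode θ and θ². The identity is invariant under rotating (x,y,z) together with
the components, so components 1 and 2 are the zeroth component for (y,z,x) and (z,x,y). -/
theorem tTriple_cyclic (h2 : (2 : k) ≠ 0) (hx : x ∈ A.gr p) (hy : y ∈ A.gr q)
    (hz : z ∈ A.gr r) (j : Fin 3) :
    A.tTriple p (q + r) x (A.mul y z) j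
      + superSign k (p * (q + r)) • A.tTriple q (r + p) y (A.mul z x) (j - 1)
      + superSign k (r * (p + q)) • A.tTriple r (p + q) z (A.mul x y) (j - 2) = 0 := by
  have h0 := tTriple_cyclic_zero h2 hx hy hz
  have h1 := tTriple_cyclic_zero h2 hy hz hx
  have h3 := tTriple_cyclic_zero h2 hz hx hy
  generalize A.tTriple p (q + r) x (A.mul y z) = a at *
  generalize A.tTriple q (r + p) y (A.mul z x) = b at *
  generalize A.tTriple r (p + q) z (A.mul x y) = c at *
  fin_cases j
  · exact h0
  · change a 1 + superSign k (p * (q + r)) • b 0 + superSign k (r * (p + q)) • c 2 = 0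
    linear_combination (norm := skip) superSign k (p * (q + r)) • h1
    clear h0 h1 h3
    induction p using ZMod.two_cases <;> induction q using ZMod.two_cases <;>
    induction r using ZMod.two_cases <;>
    simp only [superSign_zero, superSign_one, mul_zero, zero_mul, mul_one,
      one_mul, add_zero, zero_add, ZMod.two_one_add_one] <;> module
  · change a 2 + superSign k (p * (q + r)) • b 1 + superSign k (r * (p + q)) • c 0 = 0
    linear_combination (norm := skip) superSign k (r * (p + q)) • h3
    clear h0 h1 h3
    induction p using ZMod.two_cases <;> induction q using ZMod.two_cases <;>
    induction r using ZMod.two_cases <;>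
    simp only [superSign_zero, superSign_one, mul_zero, zero_mul, mul_one,
      one_mul, add_zero, zero_add, ZMod.two_one_add_one] <;> module

/-- For components 1 and 2 this says that r_x l_y and ±r_y l_x, and likewise l_x r_y and ±l_y r_x,
add up to b(x,y)1, which are the two basic identities. -/
theorem tTriple_swap (h2 : (2 : k) ≠ 0) (hx : x ∈ A.gr p) (hy : y ∈ A.gr q) :
    A.tTriple q p y x = -(superSign k (p * q) • A.tTriple p q x y) := by
  funext j
  refine A.isGrading.isInternal.linearMap_ext fun u w hw => ?_
  obtain ⟨e1, h1, h1', h1c⟩ := exists_half_b_eq h2 hx hy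
  have h1c' : 2⁻¹ * A.b y x = superSign k (p * q) * (parityDelta k p q * e1) := by
    rw [b_supersymm hx hy, ← h1c]; ring
  simp only [Pi.neg_apply, Pi.smul_apply, LinearMap.neg_apply, LinearMap.smul_apply]
  fin_cases j
  · change A.tTriple q p y x 0 w = -(_ • A.tTriple p q x y 0 w)
    rw [tTriple_zero _ _ hw, tTriple_zero _ _ hw]
    clear h1 h1' h1c h1c'
    induction p using ZMod.two_cases <;> induction q using ZMod.two_cases <;>
    induction u using ZMod.two_cases <;>
    simp only [superSign_zero, superSign_one, mul_zero, zero_mul, mul_one,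
      one_mul, add_zero, zero_add, ZMod.two_one_add_one] <;> module
  · change A.tTriple q p y x 1 w = -(_ • A.tTriple p q x y 1 w)
    rw [tTriple_one _ hx hw, tTriple_one _ hy hw, mul_mul_add hx hw hy, h1c, h1c', h1]
    clear h1 h1' h1c h1c'
    induction p using ZMod.two_cases <;> induction q using ZMod.two_cases <;>
    induction u using ZMod.two_cases <;>
    simp only [superSign_zero, superSign_one, parityDelta_zero_zero, parityDelta_one_one,
      parityDelta_zero_one, parityDelta_one_zero, mul_zero, zero_mul, mul_one,
      one_mul, add_zero, zero_add, ZMod.two_one_add_one] <;> module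
  · change A.tTriple q p y x 2 w = -(_ • A.tTriple p q x y 2 w)
    rw [tTriple_two _ _ hw, tTriple_two _ _ hw, mul_mul_add' hx hw hy, h1c, h1c', h1]
    clear h1 h1' h1c h1c'
    induction p using ZMod.two_cases <;> induction q using ZMod.two_cases <;>
    induction u using ZMod.two_cases <;>
    simp only [superSign_zero, superSign_one, parityDelta_zero_zero, parityDelta_one_one,
      parityDelta_zero_one, parityDelta_one_zero, mul_zero, zero_mul, mul_one,
      one_mul, add_zero, zero_add, ZMod.two_one_add_one] <;> module

theorem apply_mem (hd : d ∈ A.triPart p) (j : Fin 3) (hx : x ∈ A.gr q) :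
    d j x ∈ A.gr (p + q) := (hd.1 j).1 q x hx

theorem b_apply (hd : d ∈ A.triPart p) (j : Fin 3) (hx : x ∈ A.gr q) (y : S) :
    A.b (d j x) y = -(superSign k (p * q) * A.b x (d j y)) :=
  eq_neg_of_add_eq_zero_left ((hd.1 j).2 q x hx y)

/-- Local triality: pair the rule for d_0(wx) with `y` and use skewness and associativity of `b` to
move everything off `w`. Nondegeneracy then gives the rule for d_1, hence stability of tri(S) under
θ. -/
theorem apply_one_mul (hd : d ∈ A.triPart p) (hx : x ∈ A.gr q) (hy : y ∈ A.gr r) :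
    d 1 (A.mul x y) = A.mul (d 2 x) y + superSign k (p * q) • A.mul x (d 0 y) := by
  have h1 := add_assoc p q r ▸ mul_mem (apply_mem hd 2 hx) hy
  have h2 := add_left_comm q p r ▸ mul_mem hx (apply_mem hd 0 hy)
  refine eq_of_b_eq' (apply_mem hd 1 (mul_mem hx hy))
    (add_mem h1 (Submodule.smul_mem _ _ h2)) fun t w hw => ?_
  have h := congrArg (fun v => A.b v y) (hd.2 t w hw x)
  simp only [map_add, map_smul, LinearMap.add_apply, LinearMap.smul_apply, smul_eq_mul] at h ⊢
  rw [b_apply hd 0 (mul_mem hw hx), b_mul, b_mul, b_mul, b_apply hd 1 hw] at h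
  linear_combination (norm := skip) superSign k (p * t) * h
  clear h1 h2 h
  induction p using ZMod.two_cases <;> induction q using ZMod.two_cases <;>
  induction t using ZMod.two_cases <;>
  simp only [superSign_zero, superSign_one, mul_zero, zero_mul, mul_one, one_mul,
      add_zero, zero_add, ZMod.two_one_add_one] <;> ring

theorem rotate_mem_triPart (hd : d ∈ A.triPart p) : (fun j => d (j + 1)) ∈ A.triPart p :=
  mem_triPart_of_homogeneous (fun j => hd.1 (j + 1)) fun _ _ _ hx _ hy =>
    apply_one_mul hd hx hy

theorem shift_mem_triPart (hd : d ∈ A.triPart p) (i : Fin 3) :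
    (fun j => d (j + i)) ∈ A.triPart p := by
  fin_cases i
  · simpa using hd
  · exact rotate_mem_triPart hd
  · convert rotate_mem_triPart (rotate_mem_triPart hd) using 2
    rw [add_assoc]; rfl

theorem apply_mul (hd : d ∈ A.triPart p) (j : Fin 3) (hx : x ∈ A.gr q) (y : S) :
    d j (A.mul x y) = A.mul (d (j + 1) x) y + superSign k (p * q) • A.mul x (d (j + 2) y) := by
  have h := (shift_mem_triPart hd j).2 q x hx y
  simpa [add_comm] using h

theorem apply_two_mul (hd : d ∈ A.triPart p) (hx : x ∈ A.gr q) (y : S) :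
    d 2 (A.mul x y) = A.mul (d 0 x) y + superSign k (p * q) • A.mul x (d 1 y) :=
  apply_mul hd 2 hx y

theorem theta_pow_apply (i : Fin 3) (d : Fin 3 → Module.End k S) (j : Fin 3) :
    (theta ^ (i : ℕ)) d j = d (j - i) := by
  fin_cases i <;> fin_cases j <;> simp [theta, pow_succ] <;> rfl

theorem theta_pow_mem_triPart (hd : d ∈ A.triPart p) (i : Fin 3) :
    (theta ^ (i : ℕ)) d ∈ A.triPart p := by
  convert shift_mem_triPart hd (-i) using 1
  funext j
  rw [theta_pow_apply, sub_eq_add_neg]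

/-- The componentwise supercommutator of two triples of parities `p` and `q`. -/
def superComm (k : Type u) [Field k] (S : Type v) [AddCommGroup S] [Module k S]
    (p q : ZMod 2) : (Fin 3 → Module.End k S) →ₗ[k] (Fin 3 → Module.End k S) →ₗ[k]
      (Fin 3 → Module.End k S) :=
  LinearMap.mul k _ - superSign k (p * q) • (LinearMap.mul k _).flip

theorem superComm_apply (d e : Fin 3 → Module.End k S) (j : Fin 3) :
    superComm k S p q d e j = d j * e j - superSign k (p * q) • (e j * d j) := rfl

theorem superComm_apply_apply (d e : Fin 3 → Module.End k S) (j : Fin 3) (x : S) :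
    superComm k S p q d e j x = d j (e j x) - superSign k (p * q) • (e j (d j x)) := rfl

theorem superComm_mem (hd : d ∈ A.triPart p) (he : e ∈ A.triPart q) :
    superComm k S p q d e ∈ A.triPart (p + q) := by
  refine mem_triPart_of_homogeneous (fun j => mem_osp_of_homogeneous (fun r x hx => ?_)
    fun r t x hx y hy => ?_) fun r t x hx y hy => ?_
  · rw [superComm_apply_apply]
    refine sub_mem ?_ (Submodule.smul_mem _ _ ?_)
    · convert apply_mem hd j (apply_mem he j hx) using 2; ring
    · convert apply_mem he j (apply_mem hd j hx) using 2; ring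
  · simp only [superComm_apply_apply, map_sub, map_smul, LinearMap.sub_apply,
      LinearMap.smul_apply, smul_eq_mul]
    rw [b_apply hd j (apply_mem he j hx), b_apply he j (apply_mem hd j hx),
      b_apply hd j hx, b_apply he j hx]
    induction p using ZMod.two_cases <;> induction q using ZMod.two_cases <;>
    induction r using ZMod.two_cases <;>
    simp only [superSign_zero, superSign_one, mul_zero, zero_mul, mul_one, one_mul,
      add_zero, zero_add, ZMod.two_one_add_one] <;> ring
  · simp only [superComm_apply_apply]
    rw [hd.2 r x hx, he.2 r x hx]
    simp only [map_add, map_smul, map_sub, LinearMap.sub_apply, LinearMap.smul_apply]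
    rw [hd.2 _ _ (apply_mem he 1 hx), he.2 _ _ (apply_mem hd 1 hx), hd.2 r x hx, he.2 r x hx]
    induction p using ZMod.two_cases <;> induction q using ZMod.two_cases <;>
    induction r using ZMod.two_cases <;>
    simp only [superSign_zero, superSign_one, mul_zero, zero_mul, mul_one,
      one_mul, add_zero, zero_add, ZMod.two_one_add_one] <;> module

/-- On σ this is skewness of d_0. On the other two components, two uses of the rotated triality rule
move d through (yz)x and x(zy); each time `x` and `y` meet d_0. The scalar parts vanish because
b(d_0 x,y) and ±b(x,d_0 y) are opposite. -/
theorem superComm_tTriple (h2 : (2 : k) ≠ 0) (hd : d ∈ A.triPart u) (hx : x ∈ A.gr p)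
    (hy : y ∈ A.gr q) :
    superComm k S u (p + q) d (A.tTriple p q x y)
      = A.tTriple (u + p) q (d 0 x) y + superSign k (u * p) • A.tTriple p (u + q) x (d 0 y) := by
  funext j
  refine A.isGrading.isInternal.linearMap_ext fun r z hz => ?_
  rw [superComm_apply_apply]
  simp only [Pi.add_apply, Pi.smul_apply, LinearMap.add_apply, LinearMap.smul_apply]
  have hdx := apply_mem hd 0 hx
  have hdy := apply_mem hd 0 hy
  have h3 : 2⁻¹ * A.b (d 0 x) y = -(superSign k (u * p) * (2⁻¹ * A.b x (d 0 y))) := by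
    rw [b_apply hd 0 hx]; ring
  obtain ⟨e1, h1, h1', h1c⟩ := exists_half_b_eq h2 hx hy
  fin_cases j
  · change d 0 (A.tTriple p q x y 0 z) - _ • A.tTriple p q x y 0 (d 0 z)
      = A.tTriple (u + p) q (d 0 x) y 0 z + _ • A.tTriple p (u + q) x (d 0 y) 0 z
    rw [tTriple_zero _ _ hz, tTriple_zero _ _ hz, tTriple_zero _ _ hz,
      tTriple_zero _ _ (apply_mem hd 0 hz), b_apply hd 0 hx, b_apply hd 0 hy]
    simp only [map_sub, map_smul]
    rw [b_delta hx hz, b_delta hy hz]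
    generalize A.b x z = e2
    generalize A.b y z = e3
    clear h1 h1' h1c h3
    induction p using ZMod.two_cases <;> induction q using ZMod.two_cases <;>
    induction r using ZMod.two_cases <;> induction u using ZMod.two_cases <;>
    simp only [superSign_zero, superSign_one, parityDelta_zero_zero, parityDelta_one_one,
      parityDelta_zero_one, parityDelta_one_zero, mul_zero, zero_mul, mul_one,
      one_mul, add_zero, zero_add, ZMod.two_one_add_one] <;> module
  · change d 1 (A.tTriple p q x y 1 z) - _ • A.tTriple p q x y 1 (d 1 z)
      = A.tTriple (u + p) q (d 0 x) y 1 z + _ • A.tTriple p (u + q) x (d 0 y) 1 z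
    rw [tTriple_one _ hy hz, tTriple_one _ hy hz, tTriple_one _ hdy hz,
      tTriple_one _ hy (apply_mem hd 1 hz), h3, h1c]
    simp only [map_sub, map_smul]
    rw [apply_one_mul hd (mul_mem hy hz) hx, apply_two_mul hd hy]
    simp only [map_add, map_smul, LinearMap.add_apply, LinearMap.smul_apply]
    generalize A.b x (d 0 y) = e2
    clear h1 h1' h1c h3
    induction p using ZMod.two_cases <;> induction q using ZMod.two_cases <;>
    induction r using ZMod.two_cases <;> induction u using ZMod.two_cases <;>
    simp only [superSign_zero, superSign_one, parityDelta_zero_zero, parityDelta_one_one,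
      parityDelta_zero_one, parityDelta_one_zero, mul_zero, zero_mul, mul_one,
      one_mul, add_zero, zero_add, ZMod.two_one_add_one] <;> module
  · change d 2 (A.tTriple p q x y 2 z) - _ • A.tTriple p q x y 2 (d 2 z)
      = A.tTriple (u + p) q (d 0 x) y 2 z + _ • A.tTriple p (u + q) x (d 0 y) 2 z
    rw [tTriple_two _ _ hz, tTriple_two _ _ hz, tTriple_two _ _ hz,
      tTriple_two _ _ (apply_mem hd 2 hz), h3, h1c]
    simp only [map_sub, map_smul]
    rw [apply_two_mul hd hx, apply_one_mul hd hz hy]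
    simp only [map_add, map_smul]
    generalize A.b x (d 0 y) = e2
    clear h1 h1' h1c h3
    induction p using ZMod.two_cases <;> induction q using ZMod.two_cases <;>
    induction r using ZMod.two_cases <;> induction u using ZMod.two_cases <;>
    simp only [superSign_zero, superSign_one, parityDelta_zero_zero, parityDelta_one_one,
      parityDelta_zero_one, parityDelta_one_zero, mul_zero, zero_mul, mul_one,
      one_mul, add_zero, zero_add, ZMod.two_one_add_one] <;> module

theorem tTriple_odd_self_apply (hx : x ∈ A.gr 1) : A.tTriple 1 1 x x 0 x = 0 := by
  rw [tTriple_zero _ _ hx, b, A.norm.b_alt x hx]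
  simp

end Triality
end SymmetricCompositionSuperalgebra

/-! ### Parity of g(S,S') and its homogeneous generators. -/

theorem isInternal_of_projections {k : Type u} [Field k] {L : Type*} [AddCommGroup L] [Module k L]
    {ι : Type*} [Fintype ι] [DecidableEq ι] (gr : ι → Submodule k L) (P : ι → L →ₗ[k] L)
    (h1 : ∀ c, ∀ x ∈ gr c, P c x = x) (h2 : ∀ c c', c ≠ c' → ∀ x ∈ gr c, P c' x = 0)
    (h3 : ∀ x, x ∈ ⨆ c, gr c) : DirectSum.IsInternal gr := by
  rw [DirectSum.isInternal_submodule_iff_iSupIndep_and_iSup_eq_top]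
  refine ⟨fun c => Submodule.disjoint_def.2 fun x hx hx' => ?_, eq_top_iff.2 fun x _ => h3 x⟩
  have h4 : (⨆ (j) (_ : j ≠ c), gr j) ≤ LinearMap.ker (P c) :=
    iSup₂_le fun j hj y hy => h2 j c hj y hy
  rw [← h1 c x hx]
  exact h4 hx'

section Parity
variable {k : Type u} [Field k] {L : Type*} [AddCommGroup L] [Module k L]
  {gr : ZMod 2 → Submodule k L}

theorem DirectSum.IsInternal.isCompl_parity (h : DirectSum.IsInternal gr) :
    IsCompl (gr 0) (gr 1) :=
  (DirectSum.isInternal_submodule_iff_isCompl gr (i := 0) (j := 1) (by decide)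
    (by ext p; induction p using ZMod.two_cases <;> simp)).1 h

theorem DirectSum.IsInternal.exists_add_eq (h : DirectSum.IsInternal gr) (x : L) :
    ∃ y ∈ gr 0, ∃ z ∈ gr 1, y + z = x :=
  Submodule.mem_sup.1 (h.isCompl_parity.sup_eq_top ▸ Submodule.mem_top)

theorem DirectSum.IsInternal.eq_zero_of_mem (h : DirectSum.IsInternal gr) {x : L}
    (h0 : x ∈ gr 0) (h1 : x ∈ gr 1) : x = 0 :=
  Submodule.disjoint_def.1 h.isCompl_parity.disjoint x h0 h1

end Parity

namespace SymmetricCompositionSuperalgebra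

section MagicGradings

variable {k : Type u} [Field k] {S : Type v} [AddCommGroup S] [Module k S]
  {S' : Type w} [AddCommGroup S'] [Module k S']
  {A : SymmetricCompositionSuperalgebra k S} {A' : SymmetricCompositionSuperalgebra k S'}
  {p q p' q' : ZMod 2} {x : S} {x' : S'}

theorem isInternal_triGr : DirectSum.IsInternal A.triGr := by
  refine isInternal_zmod_two _ (fun d => ?_) fun d h0 h1 => ?_
  · obtain ⟨e, he, f, hf, h⟩ := Submodule.mem_sup.1 d.2
    exact Submodule.mem_sup.2 ⟨⟨e, Submodule.mem_sup_left he⟩, he,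
      ⟨f, Submodule.mem_sup_right hf⟩, hf, Subtype.ext h⟩
  -- A triple that is both even and odd sends each homogeneous element into two different parities,
  -- hence to zero.
  · refine Subtype.ext (funext fun j => A.isGrading.isInternal.linearMap_ext fun q x hx => ?_)
    have hx0 : d.1 j x ∈ A.gr (0 + q) := apply_mem h0 j hx
    have hx1 : d.1 j x ∈ A.gr (1 + q) := apply_mem h1 j hx
    exact Submodule.disjoint_def.1 (A.isGrading.isInternal.submodule_iSupIndep.pairwiseDisjoint
      (show 0 + q ≠ 1 + q by simp)) _ hx0 hx1

theorem tmul_mem_tensorGr (hx : x ∈ A.gr p) (hx' : x' ∈ A'.gr p') :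
    x ⊗ₜ[k] x' ∈ tensorGr A A' (p + p') := by
  refine Submodule.mem_iSup_of_mem p (Submodule.apply_mem_map₂ _ hx ?_)
  rwa [add_sub_cancel_left]

theorem tensorGr_le {W : Submodule k (S ⊗[k] S')}
    (h : ∀ a b, a + b = p → ∀ x ∈ A.gr a, ∀ x' ∈ A'.gr b, x ⊗ₜ[k] x' ∈ W) :
    tensorGr A A' p ≤ W :=
  iSup_le fun a => Submodule.map₂_le.2 fun x hx x' hx' => h a (p - a) (by ring) x hx x' hx'

theorem isInternal_tensorGr (h2 : (2 : k) ≠ 0) : DirectSum.IsInternal (tensorGr A A') := by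
  refine isInternal_zmod_two _ (fun v => ?_) fun v h0 h1 => ?_
  · induction v using TensorProduct.induction_on with
    | zero => exact zero_mem _
    | add v w hv hw => exact add_mem hv hw
    | tmul x x' =>
      have hx : x ∈ ⨆ p, A.gr p := A.isGrading.isInternal.submodule_iSup_eq_top ▸ trivial
      have hx' : x' ∈ ⨆ p, A'.gr p := A'.isGrading.isInternal.submodule_iSup_eq_top ▸ trivial
      induction hx using Submodule.iSup_induction' with
      | zero => simp
      | add x y _ _ h h' => rw [TensorProduct.add_tmul]; exact add_mem h h'
      | mem p x hx =>
        induction hx' using Submodule.iSup_induction' with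
        | zero => simp
        | add x y _ _ h h' => rw [TensorProduct.tmul_add]; exact add_mem h h'
        | mem p' x' hx' =>
          have h := tmul_mem_tensorGr hx hx'
          generalize p + p' = q at h
          induction q using ZMod.two_cases
          exacts [Submodule.mem_sup_left h, Submodule.mem_sup_right h]
  -- The tensor product of the two parity involutions acts on the component of parity p as the sign
  -- (-1)^p. Its eigenvalues 1 and -1 differ as 2 ≠ 0, which separates the components.
  · have key (p : ZMod 2) : tensorGr A A' p ≤ LinearMap.ker
        (TensorProduct.map (A.twist 1) (A'.twist 1) - superSign k p • LinearMap.id) := by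
      refine tensorGr_le fun a b hab x hx x' hx' => ?_
      simp [twist_apply hx, twist_apply hx', ← hab, superSign_add, TensorProduct.smul_tmul',
        smul_smul, mul_comm]
    have h3 := key 0 h0
    have h4 := key 1 h1
    simp only [superSign_zero, superSign_one, LinearMap.mem_ker, LinearMap.sub_apply,
      LinearMap.smul_apply, LinearMap.id_apply] at h3 h4
    have h5 : (2 : k) • v = 0 := by linear_combination (norm := module) h4 - h3
    exact (smul_eq_zero.1 h5).resolve_left h2

theorem isInternal_magicParity (h2 : (2 : k) ≠ 0) :
    DirectSum.IsInternal (magicParity A A') := by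
  refine isInternal_zmod_two _ (fun X => ?_) fun X h0 h1 => ?_
  · obtain ⟨d, hd, e, he, h⟩ := isInternal_triGr.exists_add_eq X.1
    obtain ⟨d', hd', e', he', h'⟩ := isInternal_triGr.exists_add_eq X.2.1
    choose v hv w hw hvw using fun i => (isInternal_tensorGr h2).exists_add_eq (X.2.2 i)
    exact Submodule.mem_sup.2 ⟨(d, d', v), ⟨hd, hd', fun i _ => hv i⟩, (e, e', w),
      ⟨he, he', fun i _ => hw i⟩, Prod.ext h (Prod.ext h' (funext hvw))⟩
  · refine Prod.ext ?_ (Prod.ext ?_ (funext fun i => ?_))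
    · exact isInternal_triGr.eq_zero_of_mem h0.1 h1.1
    · exact isInternal_triGr.eq_zero_of_mem h0.2.1 h1.2.1
    · exact (isInternal_tensorGr h2).eq_zero_of_mem (h0.2.2 i trivial) (h1.2.2 i trivial)

/-- The element of `tri(S) ⊕ tri(S')` with components `d` and `d'`. -/
def triPair (d : A.tri) (d' : A'.tri) : A.Magic A' := inTri A A' d + inTri' A A' d'

theorem triPair_eq (d : A.tri) (d' : A'.tri) : triPair d d' = (d, d', 0) := by
  simp [triPair, inTri, inTri']

theorem triPair_add (d e : A.tri) (d' e' : A'.tri) :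
    triPair d d' + triPair e e' = triPair (d + e) (d' + e') := by
  simp [triPair_eq]

theorem smul_triPair (c : k) (d : A.tri) (d' : A'.tri) :
    c • triPair d d' = triPair (c • d) (c • d') := by
  simp [triPair_eq]

theorem triPair_mem {d : A.tri} {d' : A'.tri} (hd : d ∈ A.triGr p) (hd' : d' ∈ A'.triGr p) :
    triPair d d' ∈ magicParity A A' p := by
  simp [triPair_eq, magicParity, hd, hd']

theorem iota_mem (i : Fin 3) (hx : x ∈ A.gr p) (hx' : x' ∈ A'.gr p') :
    iota A A' i (x ⊗ₜ x') ∈ magicParity A A' (p + p') := by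
  simp only [iota, magicParity, Submodule.mem_prod, LinearMap.comp_apply, LinearMap.inr_apply,
    zero_mem, true_and, Submodule.mem_pi]
  intro j _
  by_cases h : j = i
  · subst h
    simpa using tmul_mem_tensorGr hx hx'
  · simp [h]

/-- The homogeneous elements that span `g(S,S')`: the sums of an element of `tri(S)` and one of
`tri(S')`, and the `ιᵢ(x ⊗ x')` for homogeneous `x` and `x'`. -/
inductive IsGenerator (A : SymmetricCompositionSuperalgebra k S)
    (A' : SymmetricCompositionSuperalgebra k S') : ZMod 2 → A.Magic A' → Prop
  | tri {p : ZMod 2} (d : A.tri) (d' : A'.tri) (hd : d ∈ A.triGr p) (hd' : d' ∈ A'.triGr p) :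
      IsGenerator A A' p (triPair d d')
  | iota {p p' : ZMod 2} (i : Fin 3) (x : S) (x' : S') (hx : x ∈ A.gr p) (hx' : x' ∈ A'.gr p') :
      IsGenerator A A' (p + p') (iota A A' i (x ⊗ₜ x'))

theorem IsGenerator.mem {X : A.Magic A'} (h : IsGenerator A A' p X) : X ∈ magicParity A A' p := by
  cases h with
  | tri d d' hd hd' => exact triPair_mem hd hd'
  | iota i x x' hx hx' => exact iota_mem i hx hx'

theorem eq_sum_iota (X : A.Magic A') :
    X = triPair X.1 X.2.1 + ∑ i, iota A A' i (X.2.2 i) := by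
  refine Prod.ext ?_ (Prod.ext ?_ (funext fun j => ?_))
  · simp [triPair_eq, iota, Prod.fst_sum]
  · simp [triPair_eq, iota, Prod.snd_sum, Prod.fst_sum]
  · simp [triPair_eq, iota, Prod.snd_sum]

/-- The induction principle behind all reductions to generators: a linear condition is expressed as
membership in a subspace `W`, often an equaliser of two linear maps. -/
theorem magicParity_le {W : Submodule k (A.Magic A')} (h : ∀ X, IsGenerator A A' p X → X ∈ W) :
    magicParity A A' p ≤ W := by
  rintro X ⟨hd, hd', hv⟩
  rw [eq_sum_iota X]
  refine add_mem (h _ (.tri _ _ hd hd')) (sum_mem fun i _ => ?_)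
  have h1 : tensorGr A A' p ≤ W.comap (iota A A' i) := by
    refine tensorGr_le fun a b hab x hx x' hx' => ?_
    subst hab
    exact h _ (.iota i x x' hx hx')
  exact h1 (hv i trivial)

end MagicGradings
end SymmetricCompositionSuperalgebra

/-! ### The multiplication rules on generators. -/

namespace SymmetricCompositionSuperalgebra

section Rules

variable {k : Type u} [Field k] {S : Type v} [AddCommGroup S] [Module k S]
  {S' : Type w} [AddCommGroup S'] [Module k S']
  {A : SymmetricCompositionSuperalgebra k S} {A' : SymmetricCompositionSuperalgebra k S'}
  {p q r t p' q' r' t' u : ZMod 2} {x y z : S} {x' y' z' : S'} {d e f : A.tri} {d' e' f' : A'.tri}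
  {br : A.Magic A' →ₗ[k] A.Magic A' →ₗ[k] A.Magic A'} {i j l : Fin 3}

theorem triPart_le_tri (p : ZMod 2) : A.triPart p ≤ A.tri := by
  induction p using ZMod.two_cases
  exacts [le_sup_left, le_sup_right]

theorem triPair_ext (h : ∀ j, d.1 j = e.1 j) (h' : ∀ j, d'.1 j = e'.1 j) :
    triPair d d' = triPair e e' := by
  rw [show d = e from Subtype.ext (funext h), show d' = e' from Subtype.ext (funext h')]

theorem superComm_jacobi (d e f : Fin 3 → Module.End k S) :
    superComm k S p (q + r) d (superComm k S q r e f)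
      = superComm k S (p + q) r (superComm k S p q d e) f
        + superSign k (p * q) • superComm k S q (p + r) e (superComm k S p r d f) := by
  funext j
  ext x
  simp only [superComm_apply_apply, Pi.add_apply, Pi.smul_apply, LinearMap.add_apply,
    LinearMap.smul_apply, map_sub, map_smul]
  induction p using ZMod.two_cases <;> induction q using ZMod.two_cases <;>
  induction r using ZMod.two_cases <;>
  simp only [superSign_zero, superSign_one, mul_zero, zero_mul, mul_one,
    add_zero, zero_add, ZMod.two_one_add_one] <;> module

/-- Apply `superComm_tTriple` to the rotated triple j ↦ d_{j+i}, which is in tri(S) by local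
triality and has zeroth component d_i. -/
theorem superComm_theta_tTriple (h2 : (2 : k) ≠ 0) {d : Fin 3 → Module.End k S}
    (hd : d ∈ A.triPart u) (i : Fin 3) (hx : x ∈ A.gr p) (hy : y ∈ A.gr q) :
    superComm k S u (p + q) d ((theta ^ (i : ℕ)) (A.tTriple p q x y))
      = (theta ^ (i : ℕ)) (A.tTriple (u + p) q (d i x) y)
        + superSign k (u * p) • (theta ^ (i : ℕ)) (A.tTriple p (u + q) x (d i y)) := by
  funext j
  have h := congrFun (superComm_tTriple h2 (shift_mem_triPart hd i) hx hy) (j - i)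
  simpa [superComm_apply, theta_pow_apply] using h

namespace IsMagicBracket

variable (hbr : A.IsMagicBracket A' br)
include hbr

/-- The rules prescribe only the underlying triples of a bracket. The existential form supplies
elements of tri(S) and tri(S') with known parity, to which further rules can be applied. -/
theorem triPair_triPair (hd : d ∈ A.triGr p) (hd' : d' ∈ A'.triGr p) (he : e ∈ A.triGr q)
    (he' : e' ∈ A'.triGr q) : ∃ f ∈ A.triGr (p + q), ∃ f' ∈ A'.triGr (p + q),
      f.1 = superComm k S p q d.1 e.1 ∧ f'.1 = superComm k S' p q d'.1 e'.1 ∧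
      br (triPair d d') (triPair e e') = triPair f f' := by
  refine ⟨⟨_, triPart_le_tri _ (superComm_mem hd he)⟩, superComm_mem hd he,
    ⟨_, triPart_le_tri _ (superComm_mem hd' he')⟩, superComm_mem hd' he', rfl, rfl, ?_⟩
  obtain ⟨h1, h1'⟩ := hbr.tri_tri p q d e hd he
  obtain ⟨h2, h2', h2''⟩ := hbr.tri'_tri' p q d' e' hd' he'
  have h3 : br (inTri' A A' d') (inTri A A' e) = 0 := by
    have hm : inTri' A A' d' ∈ magicParity A A' p := by
      simpa [triPair] using triPair_mem (zero_mem (A.triGr p)) hd'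
    have hm' : inTri A A' e ∈ magicParity A A' q := by
      simpa [triPair] using triPair_mem he (zero_mem (A'.triGr q))
    rw [hbr.anticomm p q _ _ hm hm', hbr.tri_tri', smul_zero, neg_zero]
  simp only [triPair, map_add, LinearMap.add_apply, hbr.tri_tri', h3, add_zero, zero_add]
  rw [← triPair, triPair_eq]
  refine Prod.ext (Subtype.ext (funext fun j => ?_)) (Prod.ext (Subtype.ext (funext fun j => ?_)) ?_)
  · simp [h1, h2, superComm_apply]
  · simp [h1', h2', superComm_apply]
  · simp [h1', h2'']

theorem triPair_iota (hd' : d' ∈ A'.triGr p) (i : Fin 3) (hx : x ∈ A.gr q) (x' : S') :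
    br (triPair d d') (iota A A' i (x ⊗ₜ x')) = iota A A' i (d.1 i x ⊗ₜ x')
      + superSign k (p * q) • iota A A' i (x ⊗ₜ d'.1 i x') := by
  rw [triPair, map_add, LinearMap.add_apply, hbr.tri_iota, hbr.tri'_iota p q d' i x x' hd' hx]

theorem iota_triPair (hd : d ∈ A.triGr p) (hd' : d' ∈ A'.triGr p) (i : Fin 3) (hx : x ∈ A.gr q)
    (hx' : x' ∈ A'.gr q') :
    br (iota A A' i (x ⊗ₜ x')) (triPair d d') = -(superSign k ((q + q') * p) •
      (iota A A' i (d.1 i x ⊗ₜ x') + superSign k (p * q) • iota A A' i (x ⊗ₜ d'.1 i x'))) := by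
  rw [hbr.anticomm _ _ _ _ (iota_mem i hx hx') (triPair_mem hd hd'), hbr.triPair_iota hd' i hx]

theorem iota_next (h : j = i + 1) (h' : l = i + 2) (x : S) (hx' : x' ∈ A'.gr p')
    (hy : y ∈ A.gr q) (y' : S') :
    br (iota A A' i (x ⊗ₜ x')) (iota A A' j (y ⊗ₜ y'))
      = superSign k (p' * q) • iota A A' l (A.mul x y ⊗ₜ A'.mul x' y') := by
  subst h h'
  exact hbr.iota_succ p' q i x y x' y' hx' hy

theorem iota_prev (h : i = j + 1) (h' : l = j + 2) (hx : x ∈ A.gr p) (hx' : x' ∈ A'.gr p')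
    (hy : y ∈ A.gr q) (hy' : y' ∈ A'.gr q') :
    br (iota A A' i (x ⊗ₜ x')) (iota A A' j (y ⊗ₜ y'))
      = -(superSign k ((p + p') * (q + q')) • superSign k (q' * p) •
        iota A A' l (A.mul y x ⊗ₜ A'.mul y' x')) := by
  rw [hbr.anticomm _ _ _ _ (iota_mem i hx hx') (iota_mem j hy hy'),
    hbr.iota_next h h' y hy' hx]

theorem iota_iota_same (h2 : (2 : k) ≠ 0) (i : Fin 3) (hx : x ∈ A.gr p) (hx' : x' ∈ A'.gr p')
    (hy : y ∈ A.gr q) (hy' : y' ∈ A'.gr q') :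
    ∃ f ∈ A.triGr (p + p' + (q + q')), ∃ f' ∈ A'.triGr (p + p' + (q + q')),
      f.1 = (superSign k (q * p') * A'.b x' y') • (theta ^ (i : ℕ)) (A.tTriple p q x y) ∧
      f'.1 = (superSign k (q * p') * A.b x y) • (theta ^ (i : ℕ)) (A'.tTriple p' q' x' y') ∧
      br (iota A A' i (x ⊗ₜ x')) (iota A A' i (y ⊗ₜ y')) = triPair f f' := by
  obtain ⟨h1, h1', h1''⟩ := hbr.iota_iota p q p' q' i x y x' y' hx hy hx' hy'
  -- The scalar b'(x',y') vanishes unless x' and y' have equal parity, and then the sign is the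
  -- simpler one of the other summand. The two halves of the rule become symmetric.
  have hs : superSign k (p * p' + p * q' + q * q') * A'.b x' y'
      = superSign k (q * p') * A'.b x' y' := by
    rw [b_delta hx' hy']
    induction p using ZMod.two_cases <;> induction q using ZMod.two_cases <;>
    induction p' using ZMod.two_cases <;> induction q' using ZMod.two_cases <;>
    simp [ZMod.two_one_add_one]
  rw [hs] at h1
  have hm : (superSign k (q * p') * A'.b x' y') • (theta ^ (i : ℕ)) (A.tTriple p q x y)
      ∈ A.triPart (p + p' + (q + q')) := by
    rw [b_delta hx' hy']
    by_cases h : p' = q'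
    · subst h
      refine Submodule.smul_mem _ _ ?_
      convert theta_pow_mem_triPart (tTriple_mem h2 hx hy) i using 2
      have h0 : (2 : ZMod 2) = 0 := rfl
      linear_combination p' * h0
    · simp [parityDelta, h]
  have hm' : (superSign k (q * p') * A.b x y) • (theta ^ (i : ℕ)) (A'.tTriple p' q' x' y')
      ∈ A'.triPart (p + p' + (q + q')) := by
    rw [b_delta hx hy]
    by_cases h : p = q
    · subst h
      refine Submodule.smul_mem _ _ ?_
      convert theta_pow_mem_triPart (tTriple_mem h2 hx' hy') i using 2
      have h0 : (2 : ZMod 2) = 0 := rfl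
      linear_combination p * h0
    · simp [parityDelta, h]
  refine ⟨⟨_, triPart_le_tri _ hm⟩, hm, ⟨_, triPart_le_tri _ hm'⟩, hm', rfl, rfl, ?_⟩
  rw [triPair_eq]
  exact Prod.ext (Subtype.ext h1) (Prod.ext (Subtype.ext h1') h1'')

end IsMagicBracket

end Rules
end SymmetricCompositionSuperalgebra

/-! ### Permuting the arguments of the Jacobi identity. -/

section Jacobi
variable {k : Type u} [Field k] {L : Type*} [AddCommGroup L] [Module k L]
  {gr : ZMod 2 → Submodule k L} {mul : L →ₗ[k] L →ₗ[k] L} {p q r : ZMod 2} {x y z : L}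

/-- The Jacobi identity for elements `x`, `y`, `z`, of which `x` has parity `p` and `y` has
parity `q`. -/
def SuperJacobi (mul : L →ₗ[k] L →ₗ[k] L) (p q : ZMod 2) (x y z : L) : Prop :=
  mul x (mul y z) = mul (mul x y) z + superSign k (p * q) • mul y (mul x z)

/-- With `swap_right` this generates all permutations, so one order of each unordered type of
arguments has to be verified. -/
theorem SuperJacobi.swap_left (h : SuperJacobi mul p q x y z)
    (ha : IsSuperanticommutative gr mul) (hx : x ∈ gr p) (hy : y ∈ gr q) :
    SuperJacobi mul q p y x z := by
  unfold SuperJacobi at *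
  rw [ha q p y x hy hx, map_neg, LinearMap.neg_apply, map_smul, LinearMap.smul_apply, h]
  clear h
  induction p using ZMod.two_cases <;> induction q using ZMod.two_cases <;>
  simp only [superSign_zero, superSign_one, mul_zero, zero_mul, mul_one,
    one_mul, add_zero, zero_add, ZMod.two_one_add_one] <;> module

theorem SuperJacobi.swap_right (h : SuperJacobi mul p q x y z)
    (ha : IsSuperanticommutative gr mul) (hx : x ∈ gr p) (hy : y ∈ gr q) (hz : z ∈ gr r)
    (hm : ∀ {p q : ZMod 2} {x y : L}, x ∈ gr p → y ∈ gr q → mul x y ∈ gr (p + q)) :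
    SuperJacobi mul p r x z y := by
  unfold SuperJacobi at *
  rw [ha r q z y hz hy, map_neg, map_smul, h, ha _ _ _ _ hz (hm hx hy), ha _ _ _ _ (hm hx hz) hy]
  clear h
  induction p using ZMod.two_cases <;> induction q using ZMod.two_cases <;>
  induction r using ZMod.two_cases <;>
  simp only [superSign_zero, superSign_one, mul_zero, zero_mul, mul_one,
    one_mul, add_zero, zero_add, ZMod.two_one_add_one] <;> module

end Jacobi

/-! ### The Jacobi identity on generators, except for three distinct copies. -/

namespace SymmetricCompositionSuperalgebra

section LieSuperalgebra

variable {k : Type u} [Field k] {S : Type v} [AddCommGroup S] [Module k S]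
  {S' : Type w} [AddCommGroup S'] [Module k S']
  {A : SymmetricCompositionSuperalgebra k S} {A' : SymmetricCompositionSuperalgebra k S'}
  {p q r t p' q' r' t' u : ZMod 2} {x y z : S} {x' y' z' : S'} {d e f : A.tri} {d' e' f' : A'.tri}
  {br : A.Magic A' →ₗ[k] A.Magic A' →ₗ[k] A.Magic A'} {i j l : Fin 3}

theorem tri_apply_mem (hd : d ∈ A.triGr p) (j : Fin 3) (hx : x ∈ A.gr q) :
    d.1 j x ∈ A.gr (p + q) := apply_mem hd j hx

theorem b_tri_apply (hd : d ∈ A.triGr p) (j : Fin 3) (hx : x ∈ A.gr q) (y : S) :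
    A.b (d.1 j x) y = -(superSign k (p * q) * A.b x (d.1 j y)) := b_apply hd j hx y

theorem tri_apply_mul (hd : d ∈ A.triGr p) (j : Fin 3) (hx : x ∈ A.gr q) (y : S) :
    d.1 j (A.mul x y) = A.mul (d.1 (j + 1) x) y
      + superSign k (p * q) • A.mul x (d.1 (j + 2) y) := apply_mul hd j hx y

namespace IsMagicBracket

variable (hbr : A.IsMagicBracket A' br)
include hbr

theorem mul_mem (h2 : (2 : k) ≠ 0) {X Y : A.Magic A'} (hX : X ∈ magicParity A A' p)
    (hY : Y ∈ magicParity A A' q) : br X Y ∈ magicParity A A' (p + q) := by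
  have h1 : ∀ X, IsGenerator A A' p X → ∀ Y, IsGenerator A A' q Y →
      br X Y ∈ magicParity A A' (p + q) := by
    have h0 : ∀ {p q : ZMod 2} {d : A.tri} {d' : A'.tri} {i : Fin 3} {x : S} {x' : S'}
        {p' : ZMod 2}, d ∈ A.triGr p → d' ∈ A'.triGr p → x ∈ A.gr q → x' ∈ A'.gr p' →
        iota A A' i (d.1 i x ⊗ₜ x') + superSign k (p * q) • iota A A' i (x ⊗ₜ d'.1 i x')
          ∈ magicParity A A' (p + (q + p')) := by
      intro p q d d' i x x' p' hd hd' hx hx'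
      refine add_mem ?_ (Submodule.smul_mem _ _ ?_)
      · convert iota_mem i (tri_apply_mem hd i hx) hx' using 2; ring
      · convert iota_mem i hx (tri_apply_mem hd' i hx') using 2; ring
    rintro _ (⟨d, d', hd, hd'⟩ | @⟨p, p', i, x, x', hx, hx'⟩) _
      (⟨e, e', he, he'⟩ | @⟨q, q', j, y, y', hy, hy'⟩)
    · obtain ⟨f, hf, f', hf', -, -, h⟩ := hbr.triPair_triPair hd hd' he he'
      exact h ▸ triPair_mem hf hf'
    · rw [hbr.triPair_iota hd' j hy]
      exact h0 hd hd' hy hy'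
    · rw [hbr.iota_triPair he he' i hx hx', add_comm (p + p')]
      exact neg_mem (Submodule.smul_mem _ _ (h0 he he' hx hx'))
    · obtain rfl | rfl | h : j = i ∨ j = i + 1 ∨ i = j + 1 :=
        (by decide : ∀ i j : Fin 3, j = i ∨ j = i + 1 ∨ i = j + 1) i j
      · obtain ⟨f, hf, f', hf', -, -, h⟩ := hbr.iota_iota_same h2 j hx hx' hy hy'
        exact h ▸ triPair_mem hf hf'
      · rw [hbr.iota_next rfl rfl x hx' hy]
        convert Submodule.smul_mem _ _ (iota_mem (i + 2)
          (SymmetricCompositionSuperalgebra.mul_mem hx hy)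
          (SymmetricCompositionSuperalgebra.mul_mem hx' hy')) using 2
        ring
      · rw [hbr.iota_prev h rfl hx hx' hy hy', smul_smul]
        convert neg_mem (Submodule.smul_mem _ _ (iota_mem (j + 2)
          (SymmetricCompositionSuperalgebra.mul_mem hy hx)
          (SymmetricCompositionSuperalgebra.mul_mem hy' hx'))) using 2
        ring
  have h3 : ∀ X, IsGenerator A A' p X → br X Y ∈ magicParity A A' (p + q) := fun X hX =>
    magicParity_le (W := (magicParity A A' (p + q)).comap (br X)) (h1 X hX) hY
  exact magicParity_le (W := (magicParity A A' (p + q)).comap (br.flip Y)) h3 hX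

theorem jacobi_tri_tri_tri (hd : d ∈ A.triGr p) (hd' : d' ∈ A'.triGr p) (he : e ∈ A.triGr q)
    (he' : e' ∈ A'.triGr q) (hf : f ∈ A.triGr r) (hf' : f' ∈ A'.triGr r) :
    SuperJacobi br p q (triPair d d') (triPair e e') (triPair f f') := by
  obtain ⟨a, ha, a', ha', e1, e1', h1⟩ := hbr.triPair_triPair he he' hf hf'
  obtain ⟨b, hb, b', hb', e2, e2', h2⟩ := hbr.triPair_triPair hd hd' he he'
  obtain ⟨c, hc, c', hc', e3, e3', h3⟩ := hbr.triPair_triPair hd hd' hf hf'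
  obtain ⟨a1, -, a1', -, e4, e4', h4⟩ := hbr.triPair_triPair hd hd' ha ha'
  obtain ⟨b1, -, b1', -, e5, e5', h5⟩ := hbr.triPair_triPair hb hb' hf hf'
  obtain ⟨c1, -, c1', -, e6, e6', h6⟩ := hbr.triPair_triPair he he' hc hc'
  rw [SuperJacobi, h1, h2, h3, h4, h5, h6, smul_triPair, triPair_add]
  refine triPair_ext (fun j => congrFun (?_ : a1.1 = (b1 + superSign k (p * q) • c1).1) j)
    (fun j => congrFun (?_ : a1'.1 = (b1' + superSign k (p * q) • c1').1) j)
  · rw [Submodule.coe_add, Submodule.coe_smul, e4, e1, e5, e2, e6, e3, superComm_jacobi]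
  · rw [Submodule.coe_add, Submodule.coe_smul, e4', e1', e5', e2', e6', e3', superComm_jacobi]

theorem jacobi_tri_tri_iota (hd : d ∈ A.triGr p) (hd' : d' ∈ A'.triGr p) (he : e ∈ A.triGr q)
    (he' : e' ∈ A'.triGr q) (i : Fin 3) (hx : x ∈ A.gr r) (x' : S') :
    SuperJacobi br p q (triPair d d') (triPair e e') (iota A A' i (x ⊗ₜ x')) := by
  obtain ⟨b, hb, b', hb', e2, e2', h2⟩ := hbr.triPair_triPair hd hd' he he'
  rw [SuperJacobi, h2, hbr.triPair_iota he' i hx, hbr.triPair_iota hd' i hx,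
    hbr.triPair_iota hb' i hx, map_add, map_add, map_smul, map_smul,
    hbr.triPair_iota he' i hx, hbr.triPair_iota hd' i hx,
    hbr.triPair_iota he' i (tri_apply_mem hd i hx), hbr.triPair_iota hd' i (tri_apply_mem he i hx),
    e2, e2', superComm_apply_apply, superComm_apply_apply]
  simp only [TensorProduct.add_tmul, TensorProduct.sub_tmul, TensorProduct.tmul_add,
    TensorProduct.tmul_sub, ← TensorProduct.smul_tmul', TensorProduct.tmul_smul, map_add, map_sub,
    map_smul, map_neg, LinearMap.add_apply, LinearMap.smul_apply]
  induction p using ZMod.two_cases <;> induction q using ZMod.two_cases <;>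
  induction r using ZMod.two_cases <;>
  simp only [superSign_zero, superSign_one, mul_zero, zero_mul, mul_one,
    one_mul, add_zero, zero_add, ZMod.two_one_add_one] <;> module

/-- In the tri(S) component, the terms where d' acts on x' or y' cancel because d'_i is skew for
`b'`. The others are `superComm_theta_tTriple` times b'(x',y'). The tri(S') component is symmetric.
-/
theorem jacobi_tri_iota_same (h2 : (2 : k) ≠ 0) (hd : d ∈ A.triGr u) (hd' : d' ∈ A'.triGr u)
    (i : Fin 3) (hx : x ∈ A.gr p) (hx' : x' ∈ A'.gr p') (hy : y ∈ A.gr q) (hy' : y' ∈ A'.gr q') :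
    SuperJacobi br u (p + p') (triPair d d') (iota A A' i (x ⊗ₜ x')) (iota A A' i (y ⊗ₜ y')) := by
  have hdx := tri_apply_mem hd i hx
  have hdy := tri_apply_mem hd i hy
  have hdx' := tri_apply_mem hd' i hx'
  have hdy' := tri_apply_mem hd' i hy'
  obtain ⟨a, ha, a', ha', e1, e1', h1⟩ := hbr.iota_iota_same h2 i hx hx' hy hy'
  obtain ⟨b, -, b', -, e3, e3', h3⟩ := hbr.triPair_triPair hd hd' ha ha'
  obtain ⟨c1, -, c1', -, e4, e4', h4⟩ := hbr.iota_iota_same h2 i hdx hx' hy hy'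
  obtain ⟨c2, -, c2', -, e5, e5', h5⟩ := hbr.iota_iota_same h2 i hx hdx' hy hy'
  obtain ⟨c3, -, c3', -, e6, e6', h6⟩ := hbr.iota_iota_same h2 i hx hx' hdy hy'
  obtain ⟨c4, -, c4', -, e7, e7', h7⟩ := hbr.iota_iota_same h2 i hx hx' hy hdy'
  rw [SuperJacobi, h1, h3, hbr.triPair_iota hd' i hx, hbr.triPair_iota hd' i hy]
  simp only [map_add, map_smul, LinearMap.add_apply, LinearMap.smul_apply]
  rw [h4, h5, h6, h7]
  simp only [smul_triPair, triPair_add]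
  refine triPair_ext (fun j => congrArg (fun c => c j) (?_ : b.1 = (c1 + superSign k (u * p) • c2
    + superSign k (u * (p + p')) • (c3 + superSign k (u * q) • c4) : A.tri).1))
    (fun j => congrArg (fun c => c j) (?_ : b'.1 = (c1' + superSign k (u * p) • c2'
    + superSign k (u * (p + p')) • (c3' + superSign k (u * q) • c4') : A'.tri).1))
  · have h8 := superComm_theta_tTriple h2 (d := d.1) hd i hx hy
    simp only [Submodule.coe_add, Submodule.coe_smul, e3, e1, e4, e5, e6, e7, map_smul]
    rw [b_tri_apply hd' i hx', b_delta hx' hy']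
    clear e1 e1' h1 e3 e3' h3 e4 e4' h4 e5 e5' h5 e6 e6' h6 e7 e7' h7
    linear_combination (norm := skip)
      (superSign k (q * p') * (parityDelta k p' q' * A'.b x' y')) • h8
    simp only [superComm, LinearMap.sub_apply, LinearMap.smul_apply]
    generalize A'.b x' y' = c
    generalize A'.b x' (d'.1 i y') = c'
    induction u using ZMod.two_cases <;> induction p using ZMod.two_cases <;>
    induction p' using ZMod.two_cases <;> induction q using ZMod.two_cases <;>
    induction q' using ZMod.two_cases <;>
    simp only [superSign_zero, superSign_one, parityDelta_zero_zero, parityDelta_one_one,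
      parityDelta_zero_one, parityDelta_one_zero, mul_zero, zero_mul, mul_one,
      one_mul, add_zero, zero_add, ZMod.two_one_add_one] <;> module
  · have h8 := superComm_theta_tTriple h2 (d := d'.1) hd' i hx' hy'
    simp only [Submodule.coe_add, Submodule.coe_smul, e3', e1', e4', e5', e6', e7', map_smul]
    rw [b_tri_apply hd i hx, b_delta hx hy]
    clear e1 e1' h1 e3 e3' h3 e4 e4' h4 e5 e5' h5 e6 e6' h6 e7 e7' h7
    linear_combination (norm := skip)
      (superSign k (q * p') * (parityDelta k p q * A.b x y)) • h8
    simp only [superComm, LinearMap.sub_apply, LinearMap.smul_apply]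
    generalize A.b x y = c
    generalize A.b x (d.1 i y) = c'
    induction u using ZMod.two_cases <;> induction p using ZMod.two_cases <;>
    induction p' using ZMod.two_cases <;> induction q using ZMod.two_cases <;>
    induction q' using ZMod.two_cases <;>
    simp only [superSign_zero, superSign_one, parityDelta_zero_zero, parityDelta_one_one,
      parityDelta_zero_one, parityDelta_one_zero, mul_zero, zero_mul, mul_one,
      one_mul, add_zero, zero_add, ZMod.two_one_add_one] <;> module

/-- This is the triality rule rotated to index i + 2, where d_{i+2}(xy) involves d_i(x) and
d_{i+1}(y), used for both algebras. -/
theorem jacobi_tri_iota_next (hd : d ∈ A.triGr u) (hd' : d' ∈ A'.triGr u) (h : j = i + 1)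
    (hx : x ∈ A.gr p) (hx' : x' ∈ A'.gr p') (hy : y ∈ A.gr q) (y' : S') :
    SuperJacobi br u (p + p') (triPair d d') (iota A A' i (x ⊗ₜ x')) (iota A A' j (y ⊗ₜ y')) := by
  have hi : i + 2 + 1 = i := (by decide : ∀ i : Fin 3, i + 2 + 1 = i) i
  have hj : i + 2 + 2 = j := h ▸ (by decide : ∀ i : Fin 3, i + 2 + 2 = i + 1) i
  rw [SuperJacobi, hbr.iota_next h rfl x hx' hy, map_smul,
    hbr.triPair_iota hd' _ (SymmetricCompositionSuperalgebra.mul_mem hx hy),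
    hbr.triPair_iota hd' i hx, hbr.triPair_iota hd' j hy]
  simp only [map_add, map_smul, LinearMap.add_apply, LinearMap.smul_apply]
  rw [hbr.iota_next h rfl _ hx' hy, hbr.iota_next h rfl _ (tri_apply_mem hd' i hx') hy,
    hbr.iota_next h rfl _ hx' (tri_apply_mem hd j hy), hbr.iota_next h rfl _ hx' hy,
    tri_apply_mul hd _ hx, tri_apply_mul hd' _ hx', hi, hj]
  simp only [TensorProduct.add_tmul, TensorProduct.sub_tmul, TensorProduct.tmul_add,
    TensorProduct.tmul_sub, ← TensorProduct.smul_tmul', TensorProduct.tmul_smul, map_add, map_sub,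
    map_smul, map_neg, LinearMap.add_apply, LinearMap.smul_apply]
  induction u using ZMod.two_cases <;> induction p using ZMod.two_cases <;>
  induction p' using ZMod.two_cases <;> induction q using ZMod.two_cases <;>
  simp only [superSign_zero, superSign_one, mul_zero, zero_mul, mul_one,
    one_mul, add_zero, zero_add, ZMod.two_one_add_one] <;> module

set_option maxHeartbeats 1000000 in
-- Component i of θ^i(t_{x,y}) is σ_{x,y}, so only the two forms enter. The terms cancel by
-- supersymmetry of `b` and `b'`.
theorem jacobi_iota_same (h2 : (2 : k) ≠ 0) (i : Fin 3) (hx : x ∈ A.gr p) (hx' : x' ∈ A'.gr p')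
    (hy : y ∈ A.gr q) (hy' : y' ∈ A'.gr q') (hz : z ∈ A.gr r) (hz' : z' ∈ A'.gr r') :
    SuperJacobi br (p + p') (q + q') (iota A A' i (x ⊗ₜ x')) (iota A A' i (y ⊗ₜ y'))
      (iota A A' i (z ⊗ₜ z')) := by
  obtain ⟨a, ha, a', ha', e1, e1', h1⟩ := hbr.iota_iota_same h2 i hy hy' hz hz'
  obtain ⟨b, hb, b', hb', e3, e3', h3⟩ := hbr.iota_iota_same h2 i hx hx' hy hy'
  obtain ⟨c, hc, c', hc', e4, e4', h4⟩ := hbr.iota_iota_same h2 i hx hx' hz hz'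
  rw [SuperJacobi, h1, h3, h4, hbr.iota_triPair ha ha' i hx hx', hbr.triPair_iota hb' i hz,
    hbr.iota_triPair hc hc' i hy hy', e1, e1', e3, e3', e4, e4']
  simp only [Pi.smul_apply, theta_pow_apply, sub_self, LinearMap.smul_apply]
  rw [tTriple_zero _ _ hx, tTriple_zero _ _ hx', tTriple_zero _ _ hy, tTriple_zero _ _ hy',
    tTriple_zero _ _ hz, tTriple_zero _ _ hz']
  obtain ⟨b1, hb1, hb1'⟩ := exists_b_eq hx hy
  obtain ⟨b2, hb2, hb2'⟩ := exists_b_eq hx hz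
  obtain ⟨b3, hb3, hb3'⟩ := exists_b_eq hy hz
  obtain ⟨c1, hc1, hc1'⟩ := exists_b_eq hx' hy'
  obtain ⟨c2, hc2, hc2'⟩ := exists_b_eq hx' hz'
  obtain ⟨c3, hc3, hc3'⟩ := exists_b_eq hy' hz'
  simp only [hb1, hb1', hb2, hb2', hb3, hb3', hc1, hc1', hc2, hc2', hc3, hc3']
  clear hb1 hb1' hb2 hb2' hb3 hb3' hc1 hc1' hc2 hc2' hc3 hc3' e1 e1' h1 e3 e3' h3 e4 e4' h4
  clear ha ha' hb hb' hc hc'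
  simp only [TensorProduct.add_tmul, TensorProduct.sub_tmul, TensorProduct.tmul_add,
    TensorProduct.tmul_sub, ← TensorProduct.smul_tmul', TensorProduct.tmul_smul, map_add, map_sub,
    map_smul, map_neg, LinearMap.add_apply, LinearMap.smul_apply]
  generalize iota A A' i (x ⊗ₜ y') = v1
  generalize iota A A' i (x ⊗ₜ z') = v2
  generalize iota A A' i (y ⊗ₜ x') = v3
  generalize iota A A' i (y ⊗ₜ z') = v4
  generalize iota A A' i (z ⊗ₜ x') = v5
  generalize iota A A' i (z ⊗ₜ y') = v6
  induction p using ZMod.two_cases <;> induction p' using ZMod.two_cases <;>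
  induction q using ZMod.two_cases <;> induction q' using ZMod.two_cases <;>
  induction r using ZMod.two_cases <;> induction r' using ZMod.two_cases <;>
  simp only [superSign_zero, superSign_one, parityDelta_zero_zero, parityDelta_one_one,
    parityDelta_zero_one, parityDelta_one_zero, mul_zero, zero_mul, mul_one,
    one_mul, add_zero, zero_add, ZMod.two_one_add_one] <;> module

/-- Here θ^i(t_{x,y}) acts through its component 1. Up to signs, put a = r_x l_y, β = b(x,y), and
a', β' for S'. By `mul_mul_add`, r_y l_x = β - a, and the claim is (β - a)⊗(β' - a') - a⊗a' = β'(½β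
- a)⊗1 + β 1⊗(½β' - a'). This is where the ½ in t_{x,y} is needed. -/
theorem jacobi_iota_same_next (h2 : (2 : k) ≠ 0) (h : j = i + 1) (hx : x ∈ A.gr p)
    (hx' : x' ∈ A'.gr p') (hy : y ∈ A.gr q) (hy' : y' ∈ A'.gr q') (hz : z ∈ A.gr r)
    (hz' : z' ∈ A'.gr r') :
    SuperJacobi br (p + p') (q + q') (iota A A' i (x ⊗ₜ x')) (iota A A' i (y ⊗ₜ y'))
      (iota A A' j (z ⊗ₜ z')) := by
  obtain ⟨a, ha, a', ha', e1, e1', h1⟩ := hbr.iota_iota_same h2 i hx hx' hy hy'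
  have hl : i = i + 2 + 1 := (by decide : ∀ i : Fin 3, i = i + 2 + 1) i
  have hj : j = i + 2 + 2 := h ▸ (by decide : ∀ i : Fin 3, i + 1 = i + 2 + 2) i
  have h1j : j - i = 1 := by subst h; simp
  rw [SuperJacobi, h1, hbr.iota_next h rfl _ hy' hz, hbr.iota_next h rfl _ hx' hz, map_smul,
    map_smul, hbr.iota_prev hl hj hx hx' (SymmetricCompositionSuperalgebra.mul_mem hy hz)
      (SymmetricCompositionSuperalgebra.mul_mem hy' hz'),
    hbr.iota_prev hl hj hy hy' (SymmetricCompositionSuperalgebra.mul_mem hx hz)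
      (SymmetricCompositionSuperalgebra.mul_mem hx' hz'), hbr.triPair_iota ha' j hz, e1, e1']
  simp only [Pi.smul_apply, theta_pow_apply, h1j, LinearMap.smul_apply]
  obtain ⟨b1, hb1, -, hb2⟩ := exists_half_b_eq h2 hx hy
  obtain ⟨c1, hc1, -, hc2⟩ := exists_half_b_eq h2 hx' hy'
  rw [tTriple_one _ hy hz, tTriple_one _ hy' hz', mul_mul_add hx hz hy, mul_mul_add hx' hz' hy',
    hb2, hc2, hb1, hc1]
  clear hb1 hb2 hc1 hc2 e1 e1' h1 ha ha'
  simp only [TensorProduct.add_tmul, TensorProduct.sub_tmul, TensorProduct.tmul_add,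
    TensorProduct.tmul_sub, ← TensorProduct.smul_tmul', TensorProduct.tmul_smul, map_add, map_sub,
    map_smul, map_neg, LinearMap.add_apply, LinearMap.smul_apply]
  generalize iota A A' j (z ⊗ₜ z') = v1
  generalize iota A A' j (A.mul (A.mul y z) x ⊗ₜ z') = v2
  generalize iota A A' j (z ⊗ₜ A'.mul (A'.mul y' z') x') = v3
  generalize iota A A' j (A.mul (A.mul y z) x ⊗ₜ A'.mul (A'.mul y' z') x') = v4
  induction p using ZMod.two_cases <;> induction p' using ZMod.two_cases <;>
  induction q using ZMod.two_cases <;> induction q' using ZMod.two_cases <;>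
  induction r using ZMod.two_cases <;> induction r' using ZMod.two_cases <;>
  simp only [superSign_zero, superSign_one, parityDelta_zero_zero, parityDelta_one_one,
    parityDelta_zero_one, parityDelta_one_zero, mul_zero, zero_mul, mul_one,
    one_mul, add_zero, zero_add, ZMod.two_one_add_one] <;> module

/-- The same computation as for `jacobi_iota_same_next`, with a = l_x r_y, component 2 of the
triples, and `mul_mul_add'`. -/
theorem jacobi_iota_same_prev (h2 : (2 : k) ≠ 0) (h : j = i + 2) (hx : x ∈ A.gr p)
    (hx' : x' ∈ A'.gr p') (hy : y ∈ A.gr q) (hy' : y' ∈ A'.gr q') (hz : z ∈ A.gr r)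
    (hz' : z' ∈ A'.gr r') :
    SuperJacobi br (p + p') (q + q') (iota A A' i (x ⊗ₜ x')) (iota A A' i (y ⊗ₜ y'))
      (iota A A' j (z ⊗ₜ z')) := by
  obtain ⟨a, ha, a', ha', e1, e1', h1⟩ := hbr.iota_iota_same h2 i hx hx' hy hy'
  have hl : i = j + 1 := h ▸ (by decide : ∀ i : Fin 3, i = i + 2 + 1) i
  have hm : i + 1 = j + 2 := h ▸ (by decide : ∀ i : Fin 3, i + 1 = i + 2 + 2) i
  have h1j : j - i = 2 := by subst h; simp
  rw [SuperJacobi, h1, hbr.iota_prev hl hm hy hy' hz hz', hbr.iota_prev hl hm hx hx' hz hz',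
    hbr.triPair_iota ha' j hz, e1, e1']
  simp only [map_neg, map_smul]
  rw [hbr.iota_next rfl h _ hx' (SymmetricCompositionSuperalgebra.mul_mem hz hy),
    hbr.iota_next rfl h _ hy' (SymmetricCompositionSuperalgebra.mul_mem hz hx)]
  simp only [Pi.smul_apply, theta_pow_apply, h1j, LinearMap.smul_apply]
  obtain ⟨b1, hb1, hb3, hb2⟩ := exists_half_b_eq h2 hx hy
  obtain ⟨c1, hc1, hc3, hc2⟩ := exists_half_b_eq h2 hx' hy'
  rw [tTriple_two _ _ hz, tTriple_two _ _ hz', mul_mul_add' hy hz hx, mul_mul_add' hy' hz' hx',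
    hb2, hc2, hb1, hc1, hb3, hc3]
  clear hb1 hb2 hb3 hc1 hc2 hc3 e1 e1' h1 ha ha'
  simp only [TensorProduct.add_tmul, TensorProduct.sub_tmul, TensorProduct.tmul_add,
    TensorProduct.tmul_sub, ← TensorProduct.smul_tmul', TensorProduct.tmul_smul, map_add, map_sub,
    map_smul, map_neg, LinearMap.add_apply, LinearMap.smul_apply]
  generalize iota A A' j (z ⊗ₜ z') = v1
  generalize iota A A' j (A.mul x (A.mul z y) ⊗ₜ z') = v2
  generalize iota A A' j (z ⊗ₜ A'.mul x' (A'.mul z' y')) = v3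
  generalize iota A A' j (A.mul x (A.mul z y) ⊗ₜ A'.mul x' (A'.mul z' y')) = v4
  induction p using ZMod.two_cases <;> induction p' using ZMod.two_cases <;>
  induction q using ZMod.two_cases <;> induction q' using ZMod.two_cases <;>
  induction r using ZMod.two_cases <;> induction r' using ZMod.two_cases <;>
  simp only [superSign_zero, superSign_one, parityDelta_zero_zero, parityDelta_one_one,
    parityDelta_zero_one, parityDelta_one_zero, mul_zero, zero_mul, mul_one,
    one_mul, add_zero, zero_add, ZMod.two_one_add_one] <;> module

end IsMagicBracket

end LieSuperalgebra
end SymmetricCompositionSuperalgebra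

/-! ### The ℤ/2 × ℤ/2-grading, uniqueness, and the Lie superalgebra laws. -/

namespace SymmetricCompositionSuperalgebra

section LieSuperalgebraStructure

variable {k : Type u} [Field k] {S : Type v} [AddCommGroup S] [Module k S]
  {S' : Type w} [AddCommGroup S'] [Module k S']
  {A : SymmetricCompositionSuperalgebra k S} {A' : SymmetricCompositionSuperalgebra k S'}
  {p q r t p' q' r' t' u : ZMod 2} {x y z : S} {x' y' z' : S'} {d e f : A.tri} {d' e' f' : A'.tri}
  {br : A.Magic A' →ₗ[k] A.Magic A' →ₗ[k] A.Magic A'} {i j l : Fin 3}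

/-- The degree of `ιᵢ(S ⊗ S')` in the grading by `ℤ/2 × ℤ/2`. -/
def iotaDegree : Fin 3 → ZMod 2 × ZMod 2 := ![(1, 0), (0, 1), (1, 1)]

theorem triPair_mem_magicGr (d : A.tri) (d' : A'.tri) : triPair d d' ∈ magicGr A A' (0, 0) := by
  simp only [magicGr, if_true]
  exact Submodule.add_mem_sup ⟨d, rfl⟩ ⟨d', rfl⟩

theorem iota_mem_magicGr (i : Fin 3) (v : S ⊗[k] S') :
    iota A A' i v ∈ magicGr A A' (iotaDegree i) := by
  fin_cases i <;> simp [magicGr, iotaDegree]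

theorem magicGr_le {c : ZMod 2 × ZMod 2} {W : Submodule k (A.Magic A')}
    (h : c = (0, 0) → ∀ p, ∀ d ∈ A.triGr p, ∀ d' ∈ A'.triGr p, triPair d d' ∈ W)
    (h' : ∀ i, iotaDegree i = c → ∀ p p', ∀ x ∈ A.gr p, ∀ x' ∈ A'.gr p',
      iota A A' i (x ⊗ₜ x') ∈ W) (h2 : (2 : k) ≠ 0) : magicGr A A' c ≤ W := by
  have key (i : Fin 3) (hi : iotaDegree i = c) : LinearMap.range (iota A A' i) ≤ W := by
    rintro _ ⟨v, rfl⟩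
    obtain ⟨v0, h0, v1, h1, rfl⟩ := (isInternal_tensorGr (A := A) (A' := A') h2).exists_add_eq v
    have h3 : ∀ p, tensorGr A A' p ≤ W.comap (iota A A' i) := fun p =>
      tensorGr_le fun a b _ x hx x' hx' => h' i hi a b x hx x' hx'
    exact add_mem (h3 0 h0) (h3 1 h1)
  rw [magicGr]
  split_ifs with h3 h4 h5
  · refine sup_le ?_ ?_
    · rintro _ ⟨d, rfl⟩
      obtain ⟨d0, h0, d1, h1, rfl⟩ := (isInternal_triGr (A := A)).exists_add_eq d
      rw [map_add]
      exact add_mem (by simpa [triPair] using h h3 0 d0 h0 0 (zero_mem _))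
        (by simpa [triPair] using h h3 1 d1 h1 0 (zero_mem _))
    · rintro _ ⟨d, rfl⟩
      obtain ⟨d0, h0, d1, h1, rfl⟩ := (isInternal_triGr (A := A')).exists_add_eq d
      rw [map_add]
      exact add_mem (by simpa [triPair] using h h3 0 0 (zero_mem _) d0 h0)
        (by simpa [triPair] using h h3 1 0 (zero_mem _) d1 h1)
  · exact key 0 h4.symm
  · exact key 1 h5.symm
  · exact key 2 ((by decide : ∀ c : ZMod 2 × ZMod 2, c ≠ (0, 0) → c ≠ (1, 0) → c ≠ (0, 1) →
      iotaDegree 2 = c) c h3 h4 h5)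

theorem isInternal_magicGr : DirectSum.IsInternal (magicGr A A') := by
  -- The projections onto the four summands; they are the identity on their own summand and zero on
  -- the others.
  let P (c : ZMod 2 × ZMod 2) : A.Magic A' →ₗ[k] A.Magic A' :=
    if c = (0, 0) then LinearMap.prodMap LinearMap.id (LinearMap.prodMap LinearMap.id 0)
    else if c = (1, 0) then iota A A' 0 ∘ₗ LinearMap.proj 0 ∘ₗ LinearMap.snd k _ _ ∘ₗ
      LinearMap.snd k _ _
    else if c = (0, 1) then iota A A' 1 ∘ₗ LinearMap.proj 1 ∘ₗ LinearMap.snd k _ _ ∘ₗ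
      LinearMap.snd k _ _
    else iota A A' 2 ∘ₗ LinearMap.proj 2 ∘ₗ LinearMap.snd k _ _ ∘ₗ LinearMap.snd k _ _
  have key : ∀ c c', ∀ x ∈ magicGr A A' c, P c' x = if c = c' then x else 0 := by
    rintro ⟨c1, c2⟩ ⟨c1', c2'⟩
    induction c1 using ZMod.two_cases <;> induction c2 using ZMod.two_cases <;>
    induction c1' using ZMod.two_cases <;> induction c2' using ZMod.two_cases <;>
    simp [magicGr, P, Submodule.mem_sup, iota, inTri, inTri'] <;>
    (intros; subst_vars; rfl)
  refine isInternal_of_projections _ P (fun c x hx => by simp [key c c x hx])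
    (fun c c' h x hx => by simp [key c c' x hx, h]) fun X => ?_
  rw [eq_sum_iota X]
  exact add_mem (Submodule.mem_iSup_of_mem _ (triPair_mem_magicGr _ _)) (sum_mem fun i _ =>
    Submodule.mem_iSup_of_mem _ (iota_mem_magicGr i _))

namespace IsMagicBracket

variable (hbr : A.IsMagicBracket A' br)
include hbr

/-- In the Klein four-group every element is its own inverse and two distinct nonzero elements sum
to the third. This matches the brackets of equal copies, which land in tri(S) ⊕ tri(S'), and of
distinct copies, which land in the third. -/
theorem isAlgebraGrading_magicGr (h2 : (2 : k) ≠ 0) : IsAlgebraGrading (magicGr A A') br := by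
  refine ⟨isInternal_magicGr, ?_⟩
  intro c c' X Y hX hY
  have h1 : magicGr A A' c' ≤ (magicGr A A' (c + c')).comap (br X) := by
    refine magicGr_le ?_ ?_ h2
    · rintro rfl q e he e' he'
      refine magicGr_le (W := (magicGr A A' (c + (0, 0))).comap (br.flip (triPair e e')))
        ?_ ?_ h2 hX
      · rintro rfl p d hd d' hd'
        obtain ⟨f, hf, f', hf', -, -, h⟩ := hbr.triPair_triPair hd hd' he he'
        rw [Submodule.mem_comap, LinearMap.flip_apply, h]
        exact triPair_mem_magicGr f f'
      · rintro i rfl p p' x hx x' hx'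
        rw [Submodule.mem_comap, LinearMap.flip_apply, hbr.iota_triPair he he' i hx hx', ← map_smul, ← map_add, ← map_smul, ← map_neg]
        exact (add_zero (iotaDegree i)).symm ▸ iota_mem_magicGr i _
    · rintro j rfl q q' y hy y' hy'
      refine magicGr_le (W := (magicGr A A' (c + iotaDegree j)).comap (br.flip (iota A A' j _)))
        ?_ ?_ h2 hX
      · rintro rfl p d hd d' hd'
        rw [Submodule.mem_comap, LinearMap.flip_apply, hbr.triPair_iota hd' j hy, ← map_smul, ← map_add]
        exact (zero_add (iotaDegree j)).symm ▸ iota_mem_magicGr j _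
      · rintro i rfl p p' x hx x' hx'
        rw [Submodule.mem_comap, LinearMap.flip_apply]
        obtain rfl | rfl | h : j = i ∨ j = i + 1 ∨ i = j + 1 :=
        (by decide : ∀ i j : Fin 3, j = i ∨ j = i + 1 ∨ i = j + 1) i j
        · obtain ⟨f, hf, f', hf', -, -, h⟩ := hbr.iota_iota_same h2 j hx hx' hy hy'
          have h0 : iotaDegree j + iotaDegree j = (0, 0) :=
            (by decide : ∀ j, iotaDegree j + iotaDegree j = (0, 0)) j
          rw [h0, h]
          exact triPair_mem_magicGr f f'
        · have h0 : iotaDegree i + iotaDegree (i + 1) = iotaDegree (i + 2) :=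
            (by decide : ∀ i, iotaDegree i + iotaDegree (i + 1) = iotaDegree (i + 2)) i
          rw [hbr.iota_next rfl rfl x hx' hy, h0]
          exact Submodule.smul_mem _ _ (iota_mem_magicGr _ _)
        · have h0 : iotaDegree i + iotaDegree j = iotaDegree (j + 2) :=
            h ▸ (by decide : ∀ j, iotaDegree (j + 1) + iotaDegree j = iotaDegree (j + 2)) j
          rw [hbr.iota_prev h rfl hx hx' hy hy', h0, smul_smul]
          exact neg_mem (Submodule.smul_mem _ _ (iota_mem_magicGr _ _))
  exact h1 hY

/-- Two copies of S ⊗ S' are equal or cyclically adjacent in one of the two orders, so the rules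
with superanticommutativity leave no bracket of generators free. -/
theorem eq_of_isMagicBracket (h2 : (2 : k) ≠ 0)
    {br' : A.Magic A' →ₗ[k] A.Magic A' →ₗ[k] A.Magic A'} (hbr' : A.IsMagicBracket A' br') :
    br' = br := by
  have hg : ∀ p X, IsGenerator A A' p X → ∀ q Y, IsGenerator A A' q Y → br' X Y = br X Y := by
    rintro _ _ (⟨d, d', hd, hd'⟩ | @⟨p, p', i, x, x', hx, hx'⟩) _ _
      (⟨e, e', he, he'⟩ | @⟨q, q', j, y, y', hy, hy'⟩)
    · obtain ⟨f, -, f', -, e1, e1', h⟩ := hbr.triPair_triPair hd hd' he he'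
      obtain ⟨g, -, g', -, e3, e3', h'⟩ := hbr'.triPair_triPair hd hd' he he'
      rw [h, h', Subtype.ext (e1.trans e3.symm), Subtype.ext (e1'.trans e3'.symm)]
    · rw [hbr.triPair_iota hd' j hy, hbr'.triPair_iota hd' j hy]
    · rw [hbr.iota_triPair he he' i hx hx', hbr'.iota_triPair he he' i hx hx']
    · obtain rfl | rfl | h : j = i ∨ j = i + 1 ∨ i = j + 1 :=
        (by decide : ∀ i j : Fin 3, j = i ∨ j = i + 1 ∨ i = j + 1) i j
      · obtain ⟨f, -, f', -, e1, e1', h⟩ := hbr.iota_iota_same h2 j hx hx' hy hy'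
        obtain ⟨g, -, g', -, e3, e3', h'⟩ := hbr'.iota_iota_same h2 j hx hx' hy hy'
        rw [h, h', Subtype.ext (e1.trans e3.symm), Subtype.ext (e1'.trans e3'.symm)]
      · rw [hbr.iota_next rfl rfl x hx' hy, hbr'.iota_next rfl rfl x hx' hy]
      · rw [hbr.iota_prev h rfl hx hx' hy hy', hbr'.iota_prev h rfl hx hx' hy hy']
  have ext {f g : A.Magic A' →ₗ[k] A.Magic A'} (h : ∀ q Y, IsGenerator A A' q Y → f Y = g Y) :
      f = g := by
    refine DirectSum.IsInternal.linearMap_ext (isInternal_magicParity (A := A) (A' := A') h2)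
      fun q => ?_
    exact magicParity_le (W := LinearMap.eqLocus f g) (h q)
  have hle (p : ZMod 2) : magicParity A A' p ≤ LinearMap.eqLocus br' br :=
    magicParity_le fun X hX => ext (hg p X hX)
  refine LinearMap.ext fun X => ?_
  obtain ⟨Y, hY, Z, hZ, rfl⟩ := (isInternal_magicParity (A := A) (A' := A') h2).exists_add_eq X
  rw [map_add, map_add, hle 0 hY, hle 1 hZ]

/-- All three terms lie in tri(S) ⊕ tri(S'). Their coefficients in tri(S) agree up to sign with
b'(x',y'z') by cyclic invariance, so that component is a multiple of `tTriple_cyclic`. The other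
component is symmetric. -/
theorem jacobi_iota_cyclic (h2 : (2 : k) ≠ 0) (i : Fin 3) (hx : x ∈ A.gr p) (hx' : x' ∈ A'.gr p')
    (hy : y ∈ A.gr q) (hy' : y' ∈ A'.gr q') (hz : z ∈ A.gr r) (hz' : z' ∈ A'.gr r') :
    SuperJacobi br (p + p') (q + q') (iota A A' i (x ⊗ₜ x')) (iota A A' (i + 1) (y ⊗ₜ y'))
      (iota A A' (i + 2) (z ⊗ₜ z')) := by
  have hyz := SymmetricCompositionSuperalgebra.mul_mem hy hz
  have hyz' := SymmetricCompositionSuperalgebra.mul_mem hy' hz'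
  have hxy := SymmetricCompositionSuperalgebra.mul_mem hx hy
  have hxy' := SymmetricCompositionSuperalgebra.mul_mem hx' hy'
  have hzx := SymmetricCompositionSuperalgebra.mul_mem hz hx
  have hzx' := SymmetricCompositionSuperalgebra.mul_mem hz' hx'
  obtain ⟨a, -, a', -, e1, e1', h1⟩ := hbr.iota_iota_same h2 i hx hx' hyz hyz'
  obtain ⟨b, -, b', -, e3, e3', h3⟩ := hbr.iota_iota_same h2 (i + 2) hxy hxy' hz hz'
  obtain ⟨c, -, c', -, e4, e4', h4⟩ := hbr.iota_iota_same h2 (i + 1) hy hy' hzx hzx'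
  have i1 : i + 2 = i + 1 + 1 := (by decide : ∀ i : Fin 3, i + 2 = i + 1 + 1) i
  have i2 : i = i + 1 + 2 := (by decide : ∀ i : Fin 3, i = i + 1 + 2) i
  have i3 : i = i + 2 + 1 := (by decide : ∀ i : Fin 3, i = i + 2 + 1) i
  have i4 : i + 1 = i + 2 + 2 := (by decide : ∀ i : Fin 3, i + 1 = i + 2 + 2) i
  rw [SuperJacobi, hbr.iota_next i1 i2 _ hy' hz, hbr.iota_next rfl rfl _ hx' hy,
    hbr.iota_prev i3 i4 hx hx' hz hz', map_neg, map_smul, map_smul, map_smul, map_smul,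
    LinearMap.smul_apply, h1, h3, h4, smul_smul, smul_neg,
    ← neg_smul]
  simp only [smul_triPair, triPair_add]
  have hj1 (j : Fin 3) : j - (i + 1) = j - i - 1 := (sub_sub j i 1).symm
  have hj2 (j : Fin 3) : j - (i + 2) = j - i - 2 := (sub_sub j i 2).symm
  refine triPair_ext (fun j => ?_) (fun j => ?_)
  · have h5 := tTriple_cyclic h2 hx hy hz (j - i)
    simp only [Submodule.coe_add, Submodule.coe_smul, e1, e3, e4, Pi.add_apply, Pi.smul_apply,
      theta_pow_apply, hj1, hj2]
    -- The bracket of [x,y] with z produces t_{xy,z}, whereas the cyclic identity has t_{z,xy}.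
    rw [b_mul, b_mul_rotate hx' hy' hz', tTriple_swap h2 hz hxy, b_delta hx' hyz']
    simp only [Pi.neg_apply, Pi.smul_apply]
    clear e1 e1' h1 e3 e3' h3 e4 e4' h4
    linear_combination (norm := skip) (superSign k (q' * r) * (superSign k ((q + r) * p') *
      (parityDelta k p' (q' + r') * A'.b x' (A'.mul y' z')))) • h5
    generalize A'.b x' (A'.mul y' z') = β
    generalize A.tTriple p (q + r) x (A.mul y z) (j - i) = v1
    generalize A.tTriple q (r + p) y (A.mul z x) (j - i - 1) = v2
    generalize A.tTriple r (p + q) z (A.mul x y) (j - i - 2) = v3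
    clear h5
    induction p using ZMod.two_cases <;> induction p' using ZMod.two_cases <;>
    induction q using ZMod.two_cases <;> induction q' using ZMod.two_cases <;>
    induction r using ZMod.two_cases <;> induction r' using ZMod.two_cases <;>
    simp only [superSign_zero, superSign_one, parityDelta_zero_zero, parityDelta_one_one,
      parityDelta_zero_one, parityDelta_one_zero, mul_zero, zero_mul, mul_one,
      one_mul, add_zero, zero_add, ZMod.two_one_add_one] <;> module
  · have h5 := tTriple_cyclic h2 hx' hy' hz' (j - i)
    simp only [Submodule.coe_add, Submodule.coe_smul, e1', e3', e4', Pi.add_apply, Pi.smul_apply,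
      theta_pow_apply, hj1, hj2]
    rw [b_mul, b_mul_rotate hx hy hz, tTriple_swap h2 hz' hxy', b_delta hx hyz]
    simp only [Pi.neg_apply, Pi.smul_apply]
    clear e1 e1' h1 e3 e3' h3 e4 e4' h4
    linear_combination (norm := skip) (superSign k (q' * r) * (superSign k ((q + r) * p') *
      (parityDelta k p (q + r) * A.b x (A.mul y z)))) • h5
    generalize A.b x (A.mul y z) = β
    generalize A'.tTriple p' (q' + r') x' (A'.mul y' z') (j - i) = v1
    generalize A'.tTriple q' (r' + p') y' (A'.mul z' x') (j - i - 1) = v2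
    generalize A'.tTriple r' (p' + q') z' (A'.mul x' y') (j - i - 2) = v3
    clear h5
    induction p using ZMod.two_cases <;> induction p' using ZMod.two_cases <;>
    induction q using ZMod.two_cases <;> induction q' using ZMod.two_cases <;>
    induction r using ZMod.two_cases <;> induction r' using ZMod.two_cases <;>
    simp only [superSign_zero, superSign_one, parityDelta_zero_zero, parityDelta_one_one,
      parityDelta_zero_one, parityDelta_one_zero, mul_zero, zero_mul, mul_one,
      one_mul, add_zero, zero_add, ZMod.two_one_add_one] <;> module

theorem jacobi_iota (h2 : (2 : k) ≠ 0) (i j l : Fin 3) (hx : x ∈ A.gr p) (hx' : x' ∈ A'.gr p')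
    (hy : y ∈ A.gr q) (hy' : y' ∈ A'.gr q') (hz : z ∈ A.gr r) (hz' : z' ∈ A'.gr r') :
    SuperJacobi br (p + p') (q + q') (iota A A' i (x ⊗ₜ x')) (iota A A' j (y ⊗ₜ y'))
      (iota A A' l (z ⊗ₜ z')) := by
  have ha := hbr.anticomm
  have cases3 (j : Fin 3) : j = i ∨ j = i + 1 ∨ j = i + 2 :=
        (by decide : ∀ i j : Fin 3, j = i ∨ j = i + 1 ∨ j = i + 2) i j
  have i1 : i = i + 1 + 2 := (by decide : ∀ i : Fin 3, i = i + 1 + 2) i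
  have i2 : i = i + 2 + 1 := (by decide : ∀ i : Fin 3, i = i + 2 + 1) i
  -- The nine patterns relative to i. When j = l differs from i, the repeated copy is moved to the
  -- front and i is seen as its successor or predecessor.
  obtain rfl | rfl | rfl := cases3 j <;> obtain rfl | rfl | rfl := cases3 l
  · exact hbr.jacobi_iota_same h2 _ hx hx' hy hy' hz hz'
  · exact hbr.jacobi_iota_same_next h2 rfl hx hx' hy hy' hz hz'
  · exact hbr.jacobi_iota_same_prev h2 rfl hx hx' hy hy' hz hz'
  · exact (hbr.jacobi_iota_same_next h2 rfl hx hx' hz hz' hy hy').swap_right ha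
      (iota_mem _ hx hx') (iota_mem _ hz hz') (iota_mem _ hy hy') (hbr.mul_mem h2)
  · exact ((hbr.jacobi_iota_same_prev h2 i1 hy hy' hz hz' hx hx').swap_right ha
      (iota_mem _ hy hy') (iota_mem _ hz hz') (iota_mem _ hx hx') (hbr.mul_mem h2)).swap_left ha
      (iota_mem _ hy hy') (iota_mem _ hx hx')
  · exact hbr.jacobi_iota_cyclic h2 i hx hx' hy hy' hz hz'
  · exact (hbr.jacobi_iota_same_prev h2 rfl hx hx' hz hz' hy hy').swap_right ha
      (iota_mem _ hx hx') (iota_mem _ hz hz') (iota_mem _ hy hy') (hbr.mul_mem h2)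
  · exact (hbr.jacobi_iota_cyclic h2 i hx hx' hz hz' hy hy').swap_right ha
      (iota_mem _ hx hx') (iota_mem _ hz hz') (iota_mem _ hy hy') (hbr.mul_mem h2)
  · exact ((hbr.jacobi_iota_same_next h2 i2 hy hy' hz hz' hx hx').swap_right ha
      (iota_mem _ hy hy') (iota_mem _ hz hz') (iota_mem _ hx hx') (hbr.mul_mem h2)).swap_left ha
      (iota_mem _ hy hy') (iota_mem _ hx hx')

theorem jacobi_tri_iota (h2 : (2 : k) ≠ 0) (hd : d ∈ A.triGr u) (hd' : d' ∈ A'.triGr u)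
    (i j : Fin 3) (hx : x ∈ A.gr p) (hx' : x' ∈ A'.gr p') (hy : y ∈ A.gr q)
    (hy' : y' ∈ A'.gr q') :
    SuperJacobi br u (p + p') (triPair d d') (iota A A' i (x ⊗ₜ x')) (iota A A' j (y ⊗ₜ y')) := by
  obtain rfl | h | h : j = i ∨ j = i + 1 ∨ i = j + 1 :=
        (by decide : ∀ i j : Fin 3, j = i ∨ j = i + 1 ∨ i = j + 1) i j
  · exact hbr.jacobi_tri_iota_same h2 hd hd' j hx hx' hy hy'
  · exact hbr.jacobi_tri_iota_next hd hd' h hx hx' hy y'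
  · exact (hbr.jacobi_tri_iota_next hd hd' h hy hy' hx x').swap_right hbr.anticomm
      (triPair_mem hd hd') (iota_mem _ hy hy') (iota_mem _ hx hx') (hbr.mul_mem h2)

theorem jacobi_generator (h2 : (2 : k) ≠ 0) {X Y Z : A.Magic A'} (hX : IsGenerator A A' p X)
    (hY : IsGenerator A A' q Y) (hZ : IsGenerator A A' r Z) : SuperJacobi br p q X Y Z := by
  have ha := hbr.anticomm
  obtain ⟨d, d', hd, hd'⟩ | @⟨p, p', i, x, x', hx, hx'⟩ := hX <;>
  obtain ⟨e, e', he, he'⟩ | @⟨q, q', j, y, y', hy, hy'⟩ := hY <;>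
  obtain ⟨f, f', hf, hf'⟩ | @⟨r, r', l, z, z', hz, hz'⟩ := hZ
  · exact hbr.jacobi_tri_tri_tri hd hd' he he' hf hf'
  · exact hbr.jacobi_tri_tri_iota hd hd' he he' l hz z'
  · exact (hbr.jacobi_tri_tri_iota hd hd' hf hf' j hy y').swap_right ha (triPair_mem hd hd')
      (triPair_mem hf hf') (iota_mem _ hy hy') (hbr.mul_mem h2)
  · exact hbr.jacobi_tri_iota h2 hd hd' j l hy hy' hz hz'
  · exact ((hbr.jacobi_tri_tri_iota he he' hf hf' i hx x').swap_right ha (triPair_mem he he')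
      (triPair_mem hf hf') (iota_mem _ hx hx') (hbr.mul_mem h2)).swap_left ha
      (triPair_mem he he') (iota_mem _ hx hx')
  · exact (hbr.jacobi_tri_iota h2 he he' i l hx hx' hz hz').swap_left ha (triPair_mem he he')
      (iota_mem _ hx hx')
  · exact ((hbr.jacobi_tri_iota h2 hf hf' i j hx hx' hy hy').swap_left ha (triPair_mem hf hf')
      (iota_mem _ hx hx')).swap_right ha (iota_mem _ hx hx') (triPair_mem hf hf')
      (iota_mem _ hy hy') (hbr.mul_mem h2)
  · exact hbr.jacobi_iota h2 i j l hx hx' hy hy' hz hz'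

theorem jacobi (h2 : (2 : k) ≠ 0) {X Y Z : A.Magic A'} (hX : X ∈ magicParity A A' p)
    (hY : Y ∈ magicParity A A' q) (hZ : Z ∈ magicParity A A' r) : SuperJacobi br p q X Y Z := by
  refine magicParity_le (W := LinearMap.eqLocus (br.flip (br Y Z))
    (br.flip Z ∘ₗ br.flip Y + superSign k (p * q) • (br Y ∘ₗ br.flip Z))) (fun X hX => ?_) hX
  refine magicParity_le (W := LinearMap.eqLocus (br X ∘ₗ br.flip Z)
    (br.flip Z ∘ₗ br X + superSign k (p * q) • br.flip (br X Z))) (fun Y hY => ?_) hY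
  exact magicParity_le (W := LinearMap.eqLocus (br X ∘ₗ br Y)
    (br (br X Y) + superSign k (p * q) • (br Y ∘ₗ br X)))
    (fun Z hZ => hbr.jacobi_generator h2 hX hY hZ) hZ

/-- For an odd triple d, [d,d] = 2d², which commutes with d. For an odd tensor exactly one factor,
say x, is odd; then b(x,x) = 0 removes one half of [X,X], and σ_{x,x}(x) = 0 kills the action of the
other half. -/
theorem cube_generator (h2 : (2 : k) ≠ 0) {X : A.Magic A'} (hX : IsGenerator A A' p X)
    (hp : p = 1) : br X (br X X) = 0 := by
  obtain ⟨d, d', hd, hd'⟩ | @⟨p, p', i, x, x', hx, hx'⟩ := hX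
  · subst hp
    obtain ⟨f, hf, f', hf', e1, e1', h1⟩ := hbr.triPair_triPair hd hd' hd hd'
    obtain ⟨g, -, g', -, e3, e3', h3⟩ := hbr.triPair_triPair hd hd' hf hf'
    rw [h1, h3, show (0 : A.Magic A') = triPair 0 0 from (triPair_eq 0 0).symm]
    refine triPair_ext (fun j => ?_) (fun j => ?_)
    · simp [e3, e1, superComm_apply, ZMod.two_one_add_one, mul_add, add_mul, mul_assoc]
    · simp [e3', e1', superComm_apply, ZMod.two_one_add_one, mul_add, add_mul, mul_assoc]
  · obtain ⟨f, hf, f', hf', e1, e1', h1⟩ := hbr.iota_iota_same h2 i hx hx' hx hx'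
    rw [h1, hbr.iota_triPair hf hf' i hx hx', e1, e1']
    simp only [Pi.smul_apply, theta_pow_apply, sub_self, LinearMap.smul_apply]
    induction p using ZMod.two_cases with
    | h0 =>
      obtain rfl : p' = 1 := by simpa using hp
      rw [tTriple_odd_self_apply hx', b, A'.norm.b_alt x' hx']
      simp
    | h1 =>
      obtain rfl : p' = 0 := by simpa using hp
      rw [tTriple_odd_self_apply hx, b, A.norm.b_alt x hx]
      simp

/-- The mixed terms are 2[X,[X,Y]] + [Y,[X,X]] and the same with X and Y exchanged. Each vanishes by
the Jacobi identity for (X,X,Y) or (Y,Y,X), with no division by 3. -/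
theorem cube_add (h2 : (2 : k) ≠ 0) {X Y : A.Magic A'} (hX : X ∈ magicParity A A' 1)
    (hY : Y ∈ magicParity A A' 1) (h : br X (br X X) = 0) (h' : br Y (br Y Y) = 0) :
    br (X + Y) (br (X + Y) (X + Y)) = 0 := by
  have h3 := hbr.jacobi h2 hX hX hY
  have h4 := hbr.jacobi h2 hY hY hX
  have h5 := hbr.anticomm 1 1 Y X hY hX
  have h6 := hbr.anticomm _ 1 _ Y (hbr.mul_mem h2 hX hX) hY
  have h7 := hbr.anticomm _ 1 _ X (hbr.mul_mem h2 hY hY) hX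
  simp only [SuperJacobi] at h3 h4
  simp only [ZMod.two_one_add_one, mul_one, superSign_one, superSign_zero, one_smul, neg_smul,
    neg_neg] at h3 h4 h5 h6 h7
  rw [h6] at h3
  rw [h7, h5] at h4
  simp only [map_add, LinearMap.add_apply, h, h', h5]
  linear_combination (norm := module) h3 + h4

theorem odd_cube (h2 : (2 : k) ≠ 0) {X : A.Magic A'} (hX : X ∈ magicParity A A' 1) :
    br X (br X X) = 0 := by
  have h : X ∈ Submodule.span k {X | IsGenerator A A' 1 X} :=
    magicParity_le (fun X hX => Submodule.subset_span hX) hX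
  -- The cubic condition does not define a subspace a priori, so the induction runs over a span and
  -- carries oddness along for `cube_add`.
  have key : X ∈ magicParity A A' 1 ∧ br X (br X X) = 0 := by
    clear hX
    induction h using Submodule.span_induction with
    | mem X hX => exact ⟨hX.mem, hbr.cube_generator h2 hX rfl⟩
    | zero => simp
    | add X Y _ _ hX hY => exact ⟨add_mem hX.1 hY.1, hbr.cube_add h2 hX.1 hY.1 hX.2 hY.2⟩
    | smul c X _ hX => exact ⟨Submodule.smul_mem _ _ hX.1, by simp [hX.2]⟩
  exact key.2

theorem isLieSuperalgebra (h2 : (2 : k) ≠ 0) : IsLieSuperalgebra (magicParity A A') br where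
  grading := ⟨isInternal_magicParity h2, hbr.mul_mem h2⟩
  anticomm := hbr.anticomm
  jacobi _ _ _ _ _ _ hX hY hZ := hbr.jacobi h2 hX hY hZ
  even_self X hX := by
    have h := hbr.anticomm 0 0 X X hX hX
    simp only [mul_zero, superSign_zero, one_smul] at h
    have h3 : (2 : k) • br X X = 0 := by linear_combination (norm := module) h
    exact (smul_eq_zero.1 h3).resolve_left h2
  odd_cube _ hX := hbr.odd_cube h2 hX

end IsMagicBracket

end LieSuperalgebraStructure
end SymmetricCompositionSuperalgebra

/-! ### Construction of the bracket. -/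

namespace SymmetricCompositionSuperalgebra

section Existence

variable {k : Type u} [Field k] {S : Type v} [AddCommGroup S] [Module k S]
  {S' : Type w} [AddCommGroup S'] [Module k S']
  (A : SymmetricCompositionSuperalgebra k S) (A' : SymmetricCompositionSuperalgebra k S')

/-- The triple `t_{x,y}`, as a bilinear function of `x` and `y`. -/
noncomputable def tBilin (p q : ZMod 2) : S →ₗ[k] S →ₗ[k] (Fin 3 → Module.End k S) :=
  LinearMap.mk₂ k (A.tTriple p q)
    (fun x x' y => by
      funext j; ext z
      fin_cases j <;> simp [tTriple, sigma, rMul, lMul] <;> module)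
    (fun c x y => by
      funext j; ext z
      fin_cases j <;> simp [tTriple, sigma, rMul, lMul] <;> module)
    (fun x y y' => by
      funext j; ext z
      fin_cases j <;> simp [tTriple, sigma, rMul, lMul] <;> module)
    (fun c x y => by
      funext j; ext z
      fin_cases j <;> simp [tTriple, sigma, rMul, lMul] <;> module)

/-- A linear retraction of the triples of endomorphisms onto `tri(S)`. -/
noncomputable def triRetraction : (Fin 3 → Module.End k S) →ₗ[k] A.tri :=
  (A.tri.subtype.exists_leftInverse_of_injective A.tri.ker_subtype).choose

-- The retraction involves a choice off tri(S), but in the evaluation of the rules it is applied to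
-- elements of tri(S), where it changes nothing. It allows bilinear maps into all triples to be
-- composed before membership is known.
variable {A A'} in
theorem coe_triRetraction {d : Fin 3 → Module.End k S} {p : ZMod 2} (hd : d ∈ A.triPart p) :
    (A.triRetraction d).1 = d := by
  have h := (A.tri.subtype.exists_leftInverse_of_injective A.tri.ker_subtype).choose_spec
  exact congrArg Subtype.val (LinearMap.congr_fun h ⟨d, triPart_le_tri p hd⟩)

/-- The tensor product of two bilinear maps, with the sign `(-1)^{|x'||y|}` of the exchange of the
two middle factors of `x ⊗ x' ⊗ y ⊗ y'`. -/
noncomputable def braidedMap₂ {M N : Type*} [AddCommGroup M] [Module k M] [AddCommGroup N]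
    [Module k N] (f : S →ₗ[k] S →ₗ[k] M) (g : S' →ₗ[k] S' →ₗ[k] N) :
    S ⊗[k] S' →ₗ[k] S ⊗[k] S' →ₗ[k] M ⊗[k] N :=
  ∑ p' : ZMod 2, ∑ q : ZMod 2, superSign k (p' * q) •
    TensorProduct.map₂ (f.compl₂ (A.proj q)) (g ∘ₗ A'.proj p')

variable {A A'} in
theorem braidedMap₂_tmul {M N : Type*} [AddCommGroup M] [Module k M] [AddCommGroup N]
    [Module k N] (f : S →ₗ[k] S →ₗ[k] M) (g : S' →ₗ[k] S' →ₗ[k] N) {p' q : ZMod 2} (x : S)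
    {x' : S'} (hx' : x' ∈ A'.gr p') {y : S} (hy : y ∈ A.gr q) (y' : S') :
    braidedMap₂ A A' f g (x ⊗ₜ x') (y ⊗ₜ y') = superSign k (p' * q) • (f x y ⊗ₜ g x' y') := by
  simp only [braidedMap₂, LinearMap.sum_apply, LinearMap.smul_apply, TensorProduct.map₂_apply_tmul,
    TensorProduct.map_tmul, LinearMap.compl₂_apply, LinearMap.comp_apply, proj_eq_gradedProj,
    gradedProj_eq_delta _ _ hx', gradedProj_eq_delta _ _ hy]
  rw [Finset.sum_eq_single p', Finset.sum_eq_single q]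
  · simp [parityDelta]
  · intro r _ hr
    simp [parityDelta, hr.symm]
  · simp
  · intro r _ hr
    simp [parityDelta, hr.symm]
  · simp

/-- The action of `tri(S')` on the `j`-th copy of `S ⊗ S'`. -/
noncomputable def rightAction (j : Fin 3) : A'.tri →ₗ[k] S ⊗[k] S' →ₗ[k] S ⊗[k] S' :=
  ∑ p : ZMod 2, ∑ q : ZMod 2, superSign k (p * q) •
    (TensorProduct.mapBilinear (.id k) S S' S S' (A.proj q)) ∘ₗ LinearMap.proj j ∘ₗ
      A'.tri.subtype ∘ₗ gradedProj (isInternal_triGr (A := A')) p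

variable {A A'} in
theorem rightAction_tmul (j : Fin 3) {p q : ZMod 2} {d : A'.tri} (hd : d ∈ A'.triGr p) {x : S}
    (hx : x ∈ A.gr q) (x' : S') :
    rightAction A A' j d (x ⊗ₜ x') = superSign k (p * q) • (x ⊗ₜ d.1 j x') := by
  simp only [rightAction, LinearMap.sum_apply, LinearMap.smul_apply, LinearMap.comp_apply,
    TensorProduct.mapBilinear_apply, LinearMap.proj_apply, Submodule.subtype_apply,
    TensorProduct.map_tmul, proj_eq_gradedProj, gradedProj_eq_delta _ _ hd,
    gradedProj_eq_delta _ _ hx]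
  rw [Finset.sum_eq_single p, Finset.sum_eq_single q]
  · simp [parityDelta]
  · intro r _ hr
    simp [parityDelta, hr.symm]
  · simp
  · intro r _ hr
    simp [parityDelta, hr.symm]
  · simp

/-- The action of `tri(S)` on the `j`-th copy of `S ⊗ S'`. -/
noncomputable def leftAction (j : Fin 3) : A.tri →ₗ[k] S ⊗[k] S' →ₗ[k] S ⊗[k] S' :=
  LinearMap.rTensorHom S' ∘ₗ LinearMap.proj j ∘ₗ A.tri.subtype

/-- The component of `g(S,S')` in the `i`-th copy of `S ⊗ S'`. -/
def tensorPart (i : Fin 3) : A.Magic A' →ₗ[k] S ⊗[k] S' :=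
  LinearMap.proj i ∘ₗ LinearMap.snd k _ _ ∘ₗ LinearMap.snd k _ _

/-- The component of `g(S,S')` in `tri(S')`. -/
def triPart' : A.Magic A' →ₗ[k] A'.tri := LinearMap.fst k _ _ ∘ₗ LinearMap.snd k _ _

/-- The supercommutator on `tri(S)`, with values in the triples of endomorphisms. -/
noncomputable def triComm : A.tri →ₗ[k] A.tri →ₗ[k] (Fin 3 → Module.End k S) :=
  superExtend (isInternal_triGr (A := A)) (isInternal_triGr (A := A)) fun p q =>
    (superComm k S p q).compl₁₂ A.tri.subtype A.tri.subtype

/-- The triple `t_{x,y}`, as a bilinear function of arbitrary `x` and `y`. -/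
noncomputable def tExtend : S →ₗ[k] S →ₗ[k] (Fin 3 → Module.End k S) :=
  superExtend A.isGrading.isInternal A.isGrading.isInternal A.tBilin

/-- The brackets of `g(S,S')` that take values in `tri(S) ⊕ tri(S')`. -/
noncomputable def evenBracket : A.Magic A' →ₗ[k] A.Magic A' →ₗ[k] A.Magic A' :=
  ((triComm A).compl₁₂ (LinearMap.fst k _ _) (LinearMap.fst k _ _)).compr₂
      (inTri A A' ∘ₗ A.triRetraction)
    + ((triComm A').compl₁₂ (triPart' A A') (triPart' A A')).compr₂
      (inTri' A A' ∘ₗ A'.triRetraction)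
    + ∑ i : Fin 3, ((braidedMap₂ A A' A.tExtend A'.b).compl₁₂ (tensorPart A A' i)
        (tensorPart A A' i)).compr₂
      (inTri A A' ∘ₗ A.triRetraction ∘ₗ (theta ^ (i : ℕ)) ∘ₗ (TensorProduct.rid k _).toLinearMap)
    + ∑ i : Fin 3, ((braidedMap₂ A A' A.b A'.tExtend).compl₁₂ (tensorPart A A' i)
        (tensorPart A A' i)).compr₂
      (inTri' A A' ∘ₗ A'.triRetraction ∘ₗ (theta ^ (i : ℕ)) ∘ₗ
        (TensorProduct.lid k _).toLinearMap)

/-- One half of the brackets of `g(S,S')` that take values in the copies of `S ⊗ S'`. -/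
noncomputable def halfBracket : A.Magic A' →ₗ[k] A.Magic A' →ₗ[k] A.Magic A' :=
  ∑ j : Fin 3, ((leftAction A j).compl₁₂ (LinearMap.fst k _ _) (tensorPart A A' j)).compr₂
      (iota A A' j)
    + ∑ j : Fin 3, ((rightAction A A' j).compl₁₂ (triPart' A A') (tensorPart A A' j)).compr₂
      (iota A A' j)
    + ∑ j : Fin 3, ((braidedMap₂ A A' A.mul A'.mul).compl₁₂ (tensorPart A A' j)
      (tensorPart A A' (j + 1))).compr₂ (iota A A' (j + 2))

/-- The bracket of `g(S,S')`. -/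
noncomputable def magicBracket (h2 : (2 : k) ≠ 0) :
    A.Magic A' →ₗ[k] A.Magic A' →ₗ[k] A.Magic A' :=
  evenBracket A A' + halfBracket A A'
    + superExtend (isInternal_magicParity h2) (isInternal_magicParity h2)
      fun p q => (-superSign k (p * q)) • (halfBracket A A').flip

variable {A A'} {p q p' q' : ZMod 2} {x y : S} {x' y' : S'} {d e : A.tri} {d' e' : A'.tri}

/-- `halfBracket` treats only one order of each mixed pair, and its signed flip supplies the other.
`evenBracket` contains both orders and is superanticommutative by itself. -/
theorem magicBracket_apply (h2 : (2 : k) ≠ 0) {X Y : A.Magic A'} (hX : X ∈ magicParity A A' p)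
    (hY : Y ∈ magicParity A A' q) :
    magicBracket A A' h2 X Y = evenBracket A A' X Y + halfBracket A A' X Y
      - superSign k (p * q) • halfBracket A A' Y X := by
  rw [magicBracket, LinearMap.add_apply, LinearMap.add_apply, superExtend_apply _ _ _ hX hY,
    sub_eq_add_neg]
  exact congrArg₂ (· + ·) rfl (neg_smul (superSign k (p * q)) (halfBracket A A' Y X))

@[simp] theorem triPart'_triPair : triPart' A A' (triPair d d') = d' := by
  simp [triPart', triPair_eq]

@[simp] theorem fst_triPair : (triPair d d').1 = d := by simp [triPair_eq]

@[simp] theorem tensorPart_triPair (i : Fin 3) : tensorPart A A' i (triPair d d') = 0 := by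
  simp [tensorPart, triPair_eq]

@[simp] theorem triPart'_iota (i : Fin 3) (v : S ⊗[k] S') :
    triPart' A A' (iota A A' i v) = 0 := rfl

@[simp] theorem fst_iota (i : Fin 3) (v : S ⊗[k] S') : (iota A A' i v).1 = 0 := rfl

theorem tensorPart_iota (i j : Fin 3) (v : S ⊗[k] S') :
    tensorPart A A' i (iota A A' j v) = if i = j then v else 0 := by
  simp [tensorPart, iota, Pi.single_apply]

theorem evenBracket_triPair (hd : d ∈ A.triGr p) (hd' : d' ∈ A'.triGr p) (he : e ∈ A.triGr q)
    (he' : e' ∈ A'.triGr q) : evenBracket A A' (triPair d d') (triPair e e')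
      = triPair (A.triRetraction (superComm k S p q d.1 e.1))
        (A'.triRetraction (superComm k S' p q d'.1 e'.1)) := by
  have h1 : triComm A d e = superComm k S p q d.1 e.1 := superExtend_apply _ _ _ hd he
  have h2 : triComm A' d' e' = superComm k S' p q d'.1 e'.1 := superExtend_apply _ _ _ hd' he'
  simp only [evenBracket, LinearMap.add_apply, LinearMap.sum_apply, LinearMap.compr₂_apply,
    LinearMap.compl₁₂_apply, LinearMap.fst_apply, fst_triPair, triPart'_triPair,
    tensorPart_triPair, map_zero, LinearMap.zero_apply, Finset.sum_const_zero, add_zero, h1, h2]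
  rfl

theorem evenBracket_triPair_iota (d : A.tri) (d' : A'.tri) (i : Fin 3) (v : S ⊗[k] S') :
    evenBracket A A' (triPair d d') (iota A A' i v) = 0 := by
  simp [evenBracket]

theorem evenBracket_iota_triPair (d : A.tri) (d' : A'.tri) (i : Fin 3) (v : S ⊗[k] S') :
    evenBracket A A' (iota A A' i v) (triPair d d') = 0 := by
  simp [evenBracket]

theorem evenBracket_iota_of_ne {i j : Fin 3} (h : i ≠ j) (v w : S ⊗[k] S') :
    evenBracket A A' (iota A A' i v) (iota A A' j w) = 0 := by
  simp only [evenBracket, LinearMap.add_apply, LinearMap.sum_apply, LinearMap.compr₂_apply,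
    LinearMap.compl₁₂_apply, LinearMap.fst_apply, fst_iota, triPart'_iota, tensorPart_iota,
    map_zero, LinearMap.zero_apply, zero_add]
  rw [Finset.sum_eq_zero, Finset.sum_eq_zero, add_zero] <;>
  · intro l _
    by_cases h1 : l = i
    · subst h1
      simp [h]
    · simp [h1]

theorem evenBracket_iota (i : Fin 3) (hx : x ∈ A.gr p) (hx' : x' ∈ A'.gr p') (hy : y ∈ A.gr q)
    (hy' : y' ∈ A'.gr q') : evenBracket A A' (iota A A' i (x ⊗ₜ x')) (iota A A' i (y ⊗ₜ y'))
      = triPair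
        ((superSign k (q * p') * A'.b x' y') •
          A.triRetraction ((theta ^ (i : ℕ)) (A.tTriple p q x y)))
        ((superSign k (q * p') * A.b x y) •
          A'.triRetraction ((theta ^ (i : ℕ)) (A'.tTriple p' q' x' y'))) := by
  have h1 : A.tExtend x y = A.tTriple p q x y := superExtend_apply _ _ _ hx hy
  have h2 : A'.tExtend x' y' = A'.tTriple p' q' x' y' := superExtend_apply _ _ _ hx' hy'
  simp only [evenBracket, LinearMap.add_apply, LinearMap.sum_apply, LinearMap.compr₂_apply,
    LinearMap.compl₁₂_apply, LinearMap.fst_apply, fst_iota, triPart'_iota, map_zero,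
    tensorPart_iota, zero_add, LinearMap.zero_apply]
  rw [Finset.sum_eq_single i, Finset.sum_eq_single i]
  · simp [braidedMap₂_tmul _ _ x hx' hy y', h1, h2, triPair, mul_smul, mul_comm p' q]
  · intro j _ hj; simp [hj]
  · simp
  · intro j _ hj; simp [hj]
  · simp

theorem halfBracket_triPair (X : A.Magic A') (d : A.tri) (d' : A'.tri) :
    halfBracket A A' X (triPair d d') = 0 := by
  simp [halfBracket]

theorem halfBracket_triPair_iota (hd' : d' ∈ A'.triGr p) (i : Fin 3) (hx : x ∈ A.gr q) (x' : S') :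
    halfBracket A A' (triPair d d') (iota A A' i (x ⊗ₜ x')) = iota A A' i (d.1 i x ⊗ₜ x')
      + superSign k (p * q) • iota A A' i (x ⊗ₜ d'.1 i x') := by
  simp only [halfBracket, LinearMap.add_apply, LinearMap.sum_apply, LinearMap.compr₂_apply,
    LinearMap.compl₁₂_apply, LinearMap.fst_apply, fst_triPair, triPart'_triPair,
    tensorPart_triPair, tensorPart_iota, map_zero, LinearMap.zero_apply, Finset.sum_const_zero,
    add_zero]
  rw [Finset.sum_eq_single i, Finset.sum_eq_single i]
  · simp [rightAction_tmul i hd' hx, leftAction]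
  · intro j _ hj; simp [hj]
  · simp
  · intro j _ hj; simp [hj]
  · simp

theorem halfBracket_iota_next (i : Fin 3) (x : S) (hx' : x' ∈ A'.gr p') (hy : y ∈ A.gr q)
    (y' : S') : halfBracket A A' (iota A A' i (x ⊗ₜ x')) (iota A A' (i + 1) (y ⊗ₜ y'))
      = superSign k (p' * q) • iota A A' (i + 2) (A.mul x y ⊗ₜ A'.mul x' y') := by
  simp only [halfBracket, LinearMap.add_apply, LinearMap.sum_apply, LinearMap.compr₂_apply,
    LinearMap.compl₁₂_apply, LinearMap.fst_apply, fst_iota, triPart'_iota, tensorPart_iota,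
    map_zero, LinearMap.zero_apply, Finset.sum_const_zero, zero_add]
  rw [Finset.sum_eq_single i]
  · simp [braidedMap₂_tmul _ _ x hx' hy y']
  · intro j _ hj; simp [hj]
  · simp

theorem halfBracket_iota_of_ne {i j : Fin 3} (h : j ≠ i + 1) (v w : S ⊗[k] S') :
    halfBracket A A' (iota A A' i v) (iota A A' j w) = 0 := by
  simp only [halfBracket, LinearMap.add_apply, LinearMap.sum_apply, LinearMap.compr₂_apply,
    LinearMap.compl₁₂_apply, LinearMap.fst_apply, fst_iota, triPart'_iota, tensorPart_iota,
    map_zero, LinearMap.zero_apply, Finset.sum_const_zero, zero_add]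
  refine Finset.sum_eq_zero fun l _ => ?_
  by_cases h1 : l = i
  · subst h1
    simp [h.symm]
  · simp [h1]

theorem superComm_swap (d e : Fin 3 → Module.End k S) :
    superComm k S p q d e = -(superSign k (p * q) • superComm k S q p e d) := by
  funext j
  simp only [superComm_apply, Pi.neg_apply, Pi.smul_apply, smul_sub, smul_smul, mul_comm q p,
    superSign_mul_self, one_smul, neg_sub]

/-- On generators this combines the skewness of the supercommutator and of t_{x,y} with the
supersymmetry of the two forms. -/
theorem evenBracket_anticomm (h2 : (2 : k) ≠ 0) {X Y : A.Magic A'}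
    (hX : X ∈ magicParity A A' p) (hY : Y ∈ magicParity A A' q) :
    evenBracket A A' X Y = -(superSign k (p * q) • evenBracket A A' Y X) := by
  refine magicParity_le (W := LinearMap.eqLocus ((evenBracket A A').flip Y)
    (-(superSign k (p * q) • evenBracket A A' Y))) (fun X hX => ?_) hX
  refine magicParity_le (W := LinearMap.eqLocus (evenBracket A A' X)
    (-(superSign k (p * q) • (evenBracket A A').flip X))) (fun Y hY => ?_) hY
  change evenBracket A A' X Y = -(superSign k (p * q) • evenBracket A A' Y X)
  obtain ⟨d, d', hd, hd'⟩ | @⟨p, p', i, x, x', hx, hx'⟩ := hX <;>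
  obtain ⟨e, e', he, he'⟩ | @⟨q, q', j, y, y', hy, hy'⟩ := hY
  · rw [evenBracket_triPair hd hd' he he', evenBracket_triPair he he' hd hd', smul_triPair,
      superComm_swap d.1, superComm_swap d'.1]
    simp [triPair_eq]
  · simp [evenBracket_triPair_iota, evenBracket_iota_triPair]
  · simp [evenBracket_triPair_iota, evenBracket_iota_triPair]
  · by_cases h : i = j
    · subst h
      rw [evenBracket_iota i hx hx' hy hy', evenBracket_iota i hy hy' hx hx', smul_triPair,
        tTriple_swap h2 hx hy, tTriple_swap h2 hx' hy', b_supersymm hx hy, b_supersymm hx' hy',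
        b_delta hx hy, b_delta hx' hy']
      simp only [map_neg, map_smul, triPair_eq]
      generalize A.triRetraction _ = v1
      generalize A'.triRetraction _ = v2
      generalize A.b x y = c
      generalize A'.b x' y' = c'
      refine Prod.ext ?_ (Prod.ext ?_ ?_)
      · change _ • v1 = -(_ • _ • -(_ • v1))
        induction p using ZMod.two_cases <;> induction q using ZMod.two_cases <;>
        induction p' using ZMod.two_cases <;> induction q' using ZMod.two_cases <;>
        simp only [superSign_zero, superSign_one, parityDelta_zero_zero, parityDelta_one_one,
          parityDelta_zero_one, parityDelta_one_zero, mul_zero, zero_mul, mul_one,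
          one_mul, add_zero, zero_add, ZMod.two_one_add_one] <;> module
      · change _ • v2 = -(_ • _ • -(_ • v2))
        induction p using ZMod.two_cases <;> induction q using ZMod.two_cases <;>
        induction p' using ZMod.two_cases <;> induction q' using ZMod.two_cases <;>
        simp only [superSign_zero, superSign_one, parityDelta_zero_zero, parityDelta_one_one,
          parityDelta_zero_one, parityDelta_one_zero, mul_zero, zero_mul, mul_one,
          one_mul, add_zero, zero_add, ZMod.two_one_add_one] <;> module
      · simp
    · rw [evenBracket_iota_of_ne h, evenBracket_iota_of_ne (Ne.symm h)]
      simp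

theorem magicBracket_anticomm (h2 : (2 : k) ≠ 0) :
    IsSuperanticommutative (magicParity A A') (magicBracket A A' h2) := by
  intro p q X Y hX hY
  rw [magicBracket_apply h2 hX hY, magicBracket_apply h2 hY hX, evenBracket_anticomm h2 hX hY]
  simp only [smul_sub, smul_add, smul_smul, mul_comm q p, superSign_mul_self]
  module

theorem inTri_eq_triPair (d : A.tri) : inTri A A' d = triPair d 0 := by simp [triPair]

theorem inTri'_eq_triPair (d' : A'.tri) : inTri' A A' d' = triPair 0 d' := by simp [triPair]

theorem magicBracket_triPair (h2 : (2 : k) ≠ 0) (hd : d ∈ A.triGr p) (hd' : d' ∈ A'.triGr p)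
    (he : e ∈ A.triGr q) (he' : e' ∈ A'.triGr q) :
    magicBracket A A' h2 (triPair d d') (triPair e e')
      = triPair (A.triRetraction (superComm k S p q d.1 e.1))
        (A'.triRetraction (superComm k S' p q d'.1 e'.1)) := by
  rw [magicBracket_apply h2 (triPair_mem hd hd') (triPair_mem he he'), halfBracket_triPair,
    halfBracket_triPair, evenBracket_triPair hd hd' he he']
  simp

theorem magicBracket_triPair_iota (h2 : (2 : k) ≠ 0) (hd : d ∈ A.triGr p)
    (hd' : d' ∈ A'.triGr p) (i : Fin 3) (hx : x ∈ A.gr q) (x' : S') :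
    magicBracket A A' h2 (triPair d d') (iota A A' i (x ⊗ₜ x')) = iota A A' i (d.1 i x ⊗ₜ x')
      + superSign k (p * q) • iota A A' i (x ⊗ₜ d'.1 i x') := by
  -- The flipped half is known only on homogeneous elements, while the rule is wanted for every x';
  -- hence the detour through its even and odd parts.
  have key : ∀ q', ∀ x' ∈ A'.gr q', magicBracket A A' h2 (triPair d d') (iota A A' i (x ⊗ₜ x'))
      = iota A A' i (d.1 i x ⊗ₜ x') + superSign k (p * q) • iota A A' i (x ⊗ₜ d'.1 i x') := by
    intro q' x' hx'
    rw [magicBracket_apply h2 (triPair_mem hd hd') (iota_mem i hx hx'), halfBracket_triPair,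
      halfBracket_triPair_iota hd' i hx, evenBracket_triPair_iota]
    simp
  obtain ⟨y, hy, z, hz, rfl⟩ := A'.isGrading.isInternal.exists_add_eq x'
  simp only [TensorProduct.tmul_add, map_add, key 0 y hy, key 1 z hz, smul_add]
  abel

theorem magicBracket_iota_next (h2 : (2 : k) ≠ 0) (i : Fin 3) (x : S) (hx' : x' ∈ A'.gr p')
    (hy : y ∈ A.gr q) (y' : S') :
    magicBracket A A' h2 (iota A A' i (x ⊗ₜ x')) (iota A A' (i + 1) (y ⊗ₜ y'))
      = superSign k (p' * q) • iota A A' (i + 2) (A.mul x y ⊗ₜ A'.mul x' y') := by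
  have key : ∀ p, ∀ x ∈ A.gr p, ∀ q', ∀ y' ∈ A'.gr q',
      magicBracket A A' h2 (iota A A' i (x ⊗ₜ x')) (iota A A' (i + 1) (y ⊗ₜ y'))
        = superSign k (p' * q) • iota A A' (i + 2) (A.mul x y ⊗ₜ A'.mul x' y') := by
    intro p x hx q' y' hy'
    have h1 : i ≠ i + 1 := (by decide : ∀ i : Fin 3, i ≠ i + 1) i
    have h3 : i ≠ i + 1 + 1 := (by decide : ∀ i : Fin 3, i ≠ i + 1 + 1) i
    rw [magicBracket_apply h2 (iota_mem i hx hx') (iota_mem _ hy hy'),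
      evenBracket_iota_of_ne h1, halfBracket_iota_next i x hx' hy, halfBracket_iota_of_ne h3]
    simp
  obtain ⟨x0, hx0, x1, hx1, rfl⟩ := A.isGrading.isInternal.exists_add_eq x
  obtain ⟨y0, hy0, y1, hy1, rfl⟩ := A'.isGrading.isInternal.exists_add_eq y'
  simp only [TensorProduct.tmul_add, TensorProduct.add_tmul, map_add, LinearMap.add_apply,
    key 0 x0 hx0 0 y0 hy0, key 0 x0 hx0 1 y1 hy1, key 1 x1 hx1 0 y0 hy0, key 1 x1 hx1 1 y1 hy1,
    smul_add]

theorem magicBracket_iota_same (h2 : (2 : k) ≠ 0) (i : Fin 3) (hx : x ∈ A.gr p)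
    (hx' : x' ∈ A'.gr p') (hy : y ∈ A.gr q) (hy' : y' ∈ A'.gr q') :
    magicBracket A A' h2 (iota A A' i (x ⊗ₜ x')) (iota A A' i (y ⊗ₜ y'))
      = triPair
        ((superSign k (q * p') * A'.b x' y') •
          A.triRetraction ((theta ^ (i : ℕ)) (A.tTriple p q x y)))
        ((superSign k (q * p') * A.b x y) •
          A'.triRetraction ((theta ^ (i : ℕ)) (A'.tTriple p' q' x' y'))) := by
  have h1 : i ≠ i + 1 := (by decide : ∀ i : Fin 3, i ≠ i + 1) i
  rw [magicBracket_apply h2 (iota_mem i hx hx') (iota_mem _ hy hy'),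
    halfBracket_iota_of_ne h1, halfBracket_iota_of_ne h1, evenBracket_iota i hx hx' hy hy']
  simp

theorem isMagicBracket_magicBracket (h2 : (2 : k) ≠ 0) :
    A.IsMagicBracket A' (magicBracket A A' h2) where
  anticomm := magicBracket_anticomm h2
  tri_tri p q d e hd he := by
    rw [inTri_eq_triPair, inTri_eq_triPair,
      magicBracket_triPair h2 hd (zero_mem _) he (zero_mem _), triPair_eq]
    refine ⟨fun j => ?_, by simp⟩
    rw [coe_triRetraction (superComm_mem (d := d.1) (e := e.1) hd he), superComm_apply]
  tri'_tri' p q d e hd he := by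
    rw [inTri'_eq_triPair, inTri'_eq_triPair,
      magicBracket_triPair h2 (zero_mem _) hd (zero_mem _) he, triPair_eq]
    refine ⟨by simp, fun j => ?_, rfl⟩
    rw [coe_triRetraction (superComm_mem (d := d.1) (e := e.1) hd he), superComm_apply]
  tri_tri' d e := by
    have key : ∀ p, ∀ d ∈ A.triGr p, ∀ q, ∀ e ∈ A'.triGr q,
        magicBracket A A' h2 (triPair d 0) (triPair 0 e) = 0 := by
      intro p d hd q e he
      rw [magicBracket_triPair h2 hd (zero_mem _) (zero_mem _) he, triPair_eq]
      simp
    obtain ⟨d0, hd0, d1, hd1, rfl⟩ := (isInternal_triGr (A := A)).exists_add_eq d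
    obtain ⟨e0, he0, e1, he1, rfl⟩ := (isInternal_triGr (A := A')).exists_add_eq e
    simp only [map_add, LinearMap.add_apply, inTri_eq_triPair, inTri'_eq_triPair,
      key 0 d0 hd0 0 e0 he0, key 0 d0 hd0 1 e1 he1, key 1 d1 hd1 0 e0 he0,
      key 1 d1 hd1 1 e1 he1, add_zero]
  tri_iota d i x x' := by
    have key : ∀ p, ∀ d ∈ A.triGr p, ∀ q, ∀ x ∈ A.gr q,
        magicBracket A A' h2 (triPair d 0) (iota A A' i (x ⊗ₜ x'))
          = iota A A' i (d.1 i x ⊗ₜ x') := by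
      intro p d hd q x hx
      rw [magicBracket_triPair_iota h2 hd (zero_mem _) i hx]
      simp
    obtain ⟨d0, hd0, d1, hd1, rfl⟩ := (isInternal_triGr (A := A)).exists_add_eq d
    obtain ⟨x0, hx0, x1, hx1, rfl⟩ := A.isGrading.isInternal.exists_add_eq x
    simp only [map_add, LinearMap.add_apply, inTri_eq_triPair, TensorProduct.add_tmul,
      key 0 d0 hd0 0 x0 hx0, key 0 d0 hd0 1 x1 hx1, key 1 d1 hd1 0 x0 hx0,
      key 1 d1 hd1 1 x1 hx1, Submodule.coe_add, Pi.add_apply]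
  tri'_iota p q d i x x' hd hx := by
    rw [inTri'_eq_triPair, magicBracket_triPair_iota h2 (zero_mem _) hd i hx]
    simp
  iota_succ p' q i x y x' y' hx' hy := magicBracket_iota_next h2 i x hx' hy y'
  iota_iota p q p' q' i x y x' y' hx hy hx' hy' := by
    have hs : superSign k (p * p' + p * q' + q * q') * A'.b x' y'
        = superSign k (q * p') * A'.b x' y' := by
      rw [b_delta hx' hy']
      induction p using ZMod.two_cases <;> induction q using ZMod.two_cases <;>
      induction p' using ZMod.two_cases <;> induction q' using ZMod.two_cases <;>
      simp [ZMod.two_one_add_one]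
    rw [magicBracket_iota_same h2 i hx hx' hy hy', triPair_eq, hs]
    refine ⟨?_, ?_, rfl⟩
    · rw [Submodule.coe_smul,
        coe_triRetraction (theta_pow_mem_triPart (tTriple_mem h2 hx hy) i)]
    · rw [Submodule.coe_smul,
        coe_triRetraction (theta_pow_mem_triPart (tTriple_mem h2 hx' hy') i)]

end Existence
end SymmetricCompositionSuperalgebra

theorem mainTheorem1 {k : Type u} [Field k] (h2 : (2 : k) ≠ 0)
    {S : Type v} [AddCommGroup S] [Module k S] {S' : Type w} [AddCommGroup S'] [Module k S']
    (A : SymmetricCompositionSuperalgebra k S) (A' : SymmetricCompositionSuperalgebra k S') :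
    ∃ br : A.Magic A' →ₗ[k] A.Magic A' →ₗ[k] A.Magic A',
      A.IsMagicBracket A' br ∧
      (∀ br' : A.Magic A' →ₗ[k] A.Magic A' →ₗ[k] A.Magic A', A.IsMagicBracket A' br' → br' = br) ∧
      IsAlgebraGrading (A.magicGr A') br ∧
      IsLieSuperalgebra (A.magicParity A') br := by
  have h := SymmetricCompositionSuperalgebra.isMagicBracket_magicBracket (A := A) (A' := A') h2
  exact ⟨_, h, fun _ h' => h.eq_of_isMagicBracket h2 h', h.isAlgebraGrading_magicGr h2,
    h.isLieSuperalgebra h2⟩
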